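/- Let $G\subset\mathbb{C}^n$ be a bounded domain (nonempty, open, connected) which is $n$-circled (i.e. $(e^{i\theta_1}z_1,\dots,e^{i\theta_n}z_n)\in G$ for all $z\in G$ and $\theta\in\mathbb{R}^n$), fat (i.e. $G=\operatorname{int}\overline{G}$), and a domain of holomorphy. For $f$ holomorphic on $G$ and $\nu\in\mathbb{Z}_+^n$ write $\partial^\nu f=\partial^{|\nu|}f/\partial z_1^{\nu_1}\cdots\partial z_n^{\nu_n}$. For $k\in\mathbb{Z}_+$ let $\mathcal{A}^k(G)$ be the set of all $f\in\mathcal{O}(G)$ such that for every $\nu$ with $|\nu|\le k$ the derivative $\partial^\nu f$ extends to a continuous function on $\overline{G}$, and let $\mathcal{A}^\infty(G)=\bigcap_{k}\mathcal{A}^k(G)$. For a family $\mathcal{F}\subset\mathcal{O}(G)$, the domain $G$ is called an $\mathcal{F}$-domain of holomorphy if there are no domains $G_0,\widetilde G\subset\mathbb{C}^n$ with $\varnothing\ne G_0\subset G\cap\widetilde G$ and $\widetilde G\not\subset G$ such that for every $f\in\mathcal{F}$ there is $\widetilde f\in\mathcal{O}(\widetilde G)$ with $\widetilde f=f$ on $G_0$;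 a domain of holomorphy is an $\mathcal{O}(G)$-domain of holomorphy. For $\varepsilon\in\{0,1\}^n$ put $$V_\varepsilon=\{z\in\mathbb{C}^n : z_j=0 \text{ if } \varepsilon_j=1,\ z_j\neq 0 \text{ if } \varepsilon_j=0\},$$ $$G_\varepsilon=\{(\lambda_1^{\varepsilon_1}z_1,\dots,\lambda_n^{\varepsilon_n}z_n) : \lambda_j\in\mathbb{C},\ |\lambda_j|\le 1,\ z\in G\},$$ where $\lambda^0=1$ for every $\lambda$. Then $G$ is an $\mathcal{A}^\infty(G)$-domain of holomorphy if and only if for every $\varepsilon\in\{0,1\}^n$ with $V_\varepsilon\cap\partial G\neq\varnothing$ one has $G_\varepsilon\subset G$. -/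

import Mathlib

namespace NCircled

/-- A domain in `ℂⁿ`: a nonempty connected open set. -/
def IsComplexDomain {n : ℕ} (G : Set (Fin n → ℂ)) : Prop :=
  IsOpen G ∧ IsConnected G

/-- `G` is invariant under all rotations `z ↦ (e^{iθ₁} z₁, …, e^{iθₙ} zₙ)`. -/
def IsCircled {n : ℕ} (G : Set (Fin n → ℂ)) : Prop :=
  ∀ z ∈ G, ∀ θ : Fin n → ℝ, (fun j => Complex.exp ((θ j : ℂ) * Complex.I) * z j) ∈ G

/-- `G` is fat: it equals the interior of its closure. -/
def IsFat {n : ℕ} (G : Set (Fin n → ℂ)) : Prop :=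
  G = interior (closure G)

/-- The space `𝒪(G)`. Functions on `G` are represented by functions on `ℂⁿ`; for open `G` this
condition, and all those below, depend only on the values on `G`. -/
def holomorphicOn {n : ℕ} (G : Set (Fin n → ℂ)) : Set ((Fin n → ℂ) → ℂ) :=
  {f | DifferentiableOn ℂ f G}

/-- The complex partial derivative `∂f/∂z_j`. -/
noncomputable def partialDeriv {n : ℕ} (j : Fin n) (f : (Fin n → ℂ) → ℂ) : (Fin n → ℂ) → ℂ :=
  fun z => fderiv ℂ f z (Pi.single j 1)

/-- The derivative `∂^ν f = ∂^{|ν|} f / ∂z₁^{ν₁} ⋯ ∂zₙ^{νₙ}`. -/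
noncomputable def multiDeriv {n : ℕ} (ν : Fin n → ℕ) (f : (Fin n → ℂ) → ℂ) :
    (Fin n → ℂ) → ℂ :=
  (List.finRange n).foldr (fun j g => (partialDeriv j)^[ν j] g) f

/-- The space `𝒜^k(G)`: holomorphic functions on `G` all of whose derivatives of order at most `k`
extend continuously to the closure of `G`. -/
def spaceA {n : ℕ} (k : ℕ) (G : Set (Fin n → ℂ)) : Set ((Fin n → ℂ) → ℂ) :=
  {f | f ∈ holomorphicOn G ∧ ∀ ν : Fin n → ℕ, ∑ j, ν j ≤ k →
    ∃ g : (Fin n → ℂ) → ℂ, ContinuousOn g (closure G) ∧ Set.EqOn g (multiDeriv ν f) G}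

/-- The space `𝒜^∞(G)`. -/
def spaceAInfty {n : ℕ} (G : Set (Fin n → ℂ)) : Set ((Fin n → ℂ) → ℂ) :=
  ⋂ k : ℕ, spaceA k G

/-- `G` is an `F`-domain of holomorphy, for a family `F` of holomorphic functions on the
domain `G`: there are no domains `G₀`, `G'` with `G₀ ⊆ G ∩ G'` and `G' ⊄ G` such that every `f ∈ F`
restricted to `G₀` has a holomorphic extension to `G'`. -/
def IsDomainOfHolomorphyFor {n : ℕ} (F : Set ((Fin n → ℂ) → ℂ)) (G : Set (Fin n → ℂ)) : Prop :=
  ¬ ∃ G₀ G' : Set (Fin n → ℂ), IsComplexDomain G₀ ∧ IsComplexDomain G' ∧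
    G₀ ⊆ G ∩ G' ∧ ¬ G' ⊆ G ∧
    ∀ f ∈ F, ∃ f' ∈ holomorphicOn G', Set.EqOn f' f G₀

/-- A domain of holomorphy is an `𝒪(G)`-domain of holomorphy. -/
def IsDomainOfHolomorphy {n : ℕ} (G : Set (Fin n → ℂ)) : Prop :=
  IsDomainOfHolomorphyFor (holomorphicOn G) G

/-- The stratum `V_ε`: exactly the coordinates `z_j` with `ε_j = 1` vanish. -/
def stratum {n : ℕ} (ε : Fin n → Fin 2) : Set (Fin n → ℂ) :=
  {z | (∀ j, ε j = 1 → z j = 0) ∧ (∀ j, ε j = 0 → z j ≠ 0)}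

/-- The set `G_ε = {(λ₁^{ε₁} z₁, …, λₙ^{εₙ} zₙ) : |λ_j| ≤ 1, z ∈ G}`. -/
def partialHull {n : ℕ} (ε : Fin n → Fin 2) (G : Set (Fin n → ℂ)) : Set (Fin n → ℂ) :=
  {w | ∃ l : Fin n → ℂ, (∀ j, ‖l j‖ ≤ 1) ∧ ∃ z ∈ G, w = fun j => l j ^ (ε j : ℕ) * z j}

end NCircled

/-!
A holomorphic function on a circled domain has a Laurent expansion, whose coefficients are read off
from the Fourier coefficients on the tori. The set of logarithmic points at which the terms of such
an expansion stay bounded is convex, so the logarithmic image of a domain of holomorphy for any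
family `F` is convex. If moreover no negative powers of `z_j` occur in the expansions of the members
of `F`, the same argument shows that a fat domain is complete in the `j`-th coordinate.

If `f` is of class `𝒜^∞` and `closure G` meets `{z_j = 0}`, negative powers of `z_j` cannot occur:
differentiating away the positive powers of a term leaves a derivative of `f` which is unbounded
near `{z_j = 0}`. This gives `G_ε ⊆ G`.

Conversely, let `G` be complete in all coordinates `j` for which `closure G` meets `{z_j = 0}`. A
point `b` with nonzero coordinates outside `closure G` is separated from the convex logarithmic
image by a linear functional, which may be taken integral and is nonnegative in these coordinates.
In other words a Laurent monomial satisfies `|z^α| ≤ c < |b^α|` on `closure G` and is regular there.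
Hence `1 / (z^α - b^α)` is of class `𝒜^∞`, and it does not extend holomorphically to `b`.
-/

open MeasureTheory Metric Set Filter Topology UnitAddTorus
open scoped Pointwise

namespace NCircled

/-! ### Holomorphic maps between complex normed spaces -/

section Holomorphic

variable {E F : Type*} [NormedAddCommGroup E] [NormedSpace ℂ E]
  [NormedAddCommGroup F] [NormedSpace ℂ F]

theorem norm_fderiv_le_of_norm_le {f : E → F} {c : E} {r M : ℝ} (hr : 0 < r)
    (hf : DifferentiableOn ℂ f (ball c r)) (hM : ∀ w ∈ ball c r, ‖f w‖ ≤ M) :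
    ‖fderiv ℂ f c‖ ≤ 2 * M / r := by
  refine Complex.norm_fderiv_le_div_of_mapsTo_ball hf (fun w hw => ?_) hr
  rw [mem_closedBall, dist_eq_norm, two_mul]
  exact (norm_sub_le _ _).trans (add_le_add (hM w hw) (hM c (mem_ball_self hr)))

/-- Apply Cauchy's estimate twice: to `f`, and to the difference of `f` and a translate of `f`,
which is small by the mean value inequality. -/
theorem norm_fderiv_sub_fderiv_le {f : E → F} {c x y : E} {r M : ℝ} (hr : 0 < r)
    (hf : DifferentiableOn ℂ f (ball c (3 * r))) (hM : ∀ w ∈ ball c (3 * r), ‖f w‖ ≤ M)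
    (hx : x ∈ ball c r) (hy : y ∈ ball c r) :
    ‖fderiv ℂ f y - fderiv ℂ f x‖ ≤ 2 * (2 * M / r * ‖y - x‖) / r := by
  let : NormedSpace ℝ E := NormedSpace.restrictScalars ℝ ℂ E
  have hsub {w : E} {s : ℝ} (hw : w ∈ ball c s) : ball w r ⊆ ball c (s + r) :=
    ball_subset_ball' (by linarith [mem_ball.1 hw])
  have hdiff {w : E} (hw : w ∈ ball c (2 * r)) : DifferentiableAt ℂ f w :=
    hf.differentiableAt (isOpen_ball.mem_nhds (ball_subset_ball (by linarith) hw))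
  have hfderiv {w : E} (hw : w ∈ ball c (2 * r)) : ‖fderiv ℂ f w‖ ≤ 2 * M / r := by
    have hw' : ball w r ⊆ ball c (3 * r) := (hsub hw).trans (ball_subset_ball (by linarith))
    exact norm_fderiv_le_of_norm_le hr (hf.mono hw') fun v hv => hM v (hw' hv)
  have hmem {w : E} (hw : w ∈ ball x r) : w ∈ ball c (2 * r) ∧ w + (y - x) ∈ ball c (2 * r) := by
    rw [two_mul]
    refine ⟨hsub hx hw, hsub hy ?_⟩
    rwa [mem_ball, dist_eq_norm, add_sub_assoc, sub_sub_cancel_left, ← sub_eq_add_neg,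
      ← dist_eq_norm]
  have htranslate {w : E} (hw : w ∈ ball x r) :
      HasFDerivAt (fun w => f (w + (y - x)) - f w)
        (fderiv ℂ f (w + (y - x)) - fderiv ℂ f w) w :=
    ((hasFDerivAt_comp_add_right (y - x)).2 (hdiff (hmem hw).2).hasFDerivAt).fun_sub
      (hdiff (hmem hw).1).hasFDerivAt
  have hcauchy := norm_fderiv_le_of_norm_le (M := 2 * M / r * ‖y - x‖) hr
    (fun w hw => (htranslate hw).differentiableAt.differentiableWithinAt) fun w hw => by
      simpa using (convex_ball c (2 * r)).norm_image_sub_le_of_norm_fderiv_le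
        (fun v hv => hdiff hv) (fun v hv => hfderiv hv) (hmem hw).1 (hmem hw).2
  simpa [(htranslate (mem_ball_self hr)).fderiv] using hcauchy

theorem exists_norm_fderiv_sub_fderiv_le {f : E → F} {U : Set E} (hU : IsOpen U)
    (hf : DifferentiableOn ℂ f U) {c : E} (hc : c ∈ U) :
    ∃ r > 0, ∃ K, 0 ≤ K ∧ ball c r ⊆ U ∧
      ∀ x ∈ ball c r, ∀ y ∈ ball c r, ‖fderiv ℂ f y - fderiv ℂ f x‖ ≤ K * ‖y - x‖ := by
  have hbdd : ∀ᶠ w in 𝓝 c, w ∈ U ∧ ‖f w‖ ≤ ‖f c‖ + 1 :=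
    (hU.eventually_mem hc).and <| ((hf.continuousOn.continuousAt (hU.mem_nhds hc)).norm.eventually
      (eventually_lt_nhds (lt_add_one _))).mono fun _ h => h.le
  obtain ⟨s, hs, hball⟩ := Metric.eventually_nhds_iff_ball.1 hbdd
  obtain ⟨r, rfl⟩ : ∃ r, s = 3 * r := ⟨s / 3, by ring⟩
  have hr : 0 < r := by linarith
  refine ⟨r, hr, 4 * (‖f c‖ + 1) / r ^ 2, by positivity,
    fun w hw => (hball w (ball_subset_ball (by linarith) hw)).1, fun x hx y hy => ?_⟩
  exact (norm_fderiv_sub_fderiv_le hr (hf.mono fun w hw => (hball w hw).1)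
    (fun w hw => (hball w hw).2) hx hy).trans_eq (by ring)

theorem continuousOn_fderiv {f : E → F} {U : Set E} (hU : IsOpen U)
    (hf : DifferentiableOn ℂ f U) : ContinuousOn (fderiv ℂ f) U := by
  intro c hc
  obtain ⟨r, hr, K, -, -, hK⟩ := exists_norm_fderiv_sub_fderiv_le hU hf hc
  have hlip : ∀ᶠ y in 𝓝 c, ‖fderiv ℂ f y - fderiv ℂ f c‖ ≤ K * ‖y - c‖ := by
    filter_upwards [ball_mem_nhds c hr] with y hy using hK c (mem_ball_self hr) y hy
  have hzero : Tendsto (fun y => K * ‖y - c‖) (𝓝 c) (𝓝 0) := by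
    have hcont : Continuous fun y => K * ‖y - c‖ := by fun_prop
    simpa using hcont.tendsto c
  have hlim : Tendsto (fderiv ℂ f) (𝓝 c) (𝓝 (fderiv ℂ f c)) :=
    tendsto_iff_norm_sub_tendsto_zero.2
      (squeeze_zero' (.of_forall fun _ => norm_nonneg _) hlip hzero)
  exact hlim.mono_left nhdsWithin_le_nhds

/-- Weierstrass' theorem: by Cauchy's estimate, the derivatives of a uniformly Cauchy family of
holomorphic maps are uniformly Cauchy on a smaller ball. -/
theorem differentiableAt_of_tendstoUniformlyOn_ball [CompleteSpace F] {ι : Type*} {l : Filter ι}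
    [l.NeBot] {f : ι → E → F} {g : E → F} {c : E} {r : ℝ} (hr : 0 < r)
    (hf : ∀ i, DifferentiableOn ℂ (f i) (ball c r))
    (hfg : TendstoUniformlyOn f g l (ball c r)) : DifferentiableAt ℂ g c := by
  have hsub {w : E} (hw : w ∈ ball c (r / 2)) : ball w (r / 2) ⊆ ball c r :=
    ball_subset_ball' (by linarith [mem_ball.1 hw])
  have hmem {w : E} (hw : w ∈ ball c (r / 2)) : w ∈ ball c r :=
    ball_subset_ball (by linarith) hw
  have hdiff (i : ι) {w : E} (hw : w ∈ ball c r) : DifferentiableAt ℂ (f i) w :=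
    (hf i).differentiableAt (isOpen_ball.mem_nhds hw)
  have hcauchy : UniformCauchySeqOn (fun i => fderiv ℂ (f i)) l (ball c (r / 2)) := by
    have hf0 := hfg.uniformCauchySeqOn
    rw [SeminormedAddGroup.uniformCauchySeqOn_iff_tendstoUniformlyOn_zero,
      Metric.tendstoUniformlyOn_iff] at hf0 ⊢
    intro ε hε
    filter_upwards [hf0 (ε * r / 8) (by positivity)] with i hi w hw
    have hest := norm_fderiv_le_of_norm_le (M := ε * r / 8) (half_pos hr)
      (((hf i.1).sub (hf i.2)).mono (hsub hw)) fun v hv => by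
        simpa [dist_eq_norm, neg_add_eq_sub, norm_sub_rev] using (hi v (hsub hw hv)).le
    rw [fderiv_sub (hdiff i.1 (hmem hw)) (hdiff i.2 (hmem hw))] at hest
    rw [Pi.zero_apply, dist_zero_left, neg_add_eq_sub, norm_sub_rev]
    have hε' : 2 * (ε * r / 8) / (r / 2) = ε / 2 := by field_simp; norm_num
    exact (hest.trans_eq hε').trans_lt (half_lt_self hε)
  have hlim (w : E) (hw : w ∈ ball c (r / 2)) :
      ∃ g', Tendsto (fun i => fderiv ℂ (f i) w) l (𝓝 g') :=
    cauchy_map_iff_exists_tendsto.1 (hcauchy.cauchy_map hw)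
  choose! g' hg' using hlim
  exact (hasFDerivAt_of_tendstoUniformlyOn isOpen_ball (hcauchy.tendstoUniformlyOn_of_tendsto hg')
    (fun i w hw => (hdiff i (hmem hw)).hasFDerivAt) (fun w hw => hfg.tendsto_at (hmem hw))
    (mem_ball_self (half_pos hr))).differentiableAt

theorem differentiableAt_tsum_of_norm_le [CompleteSpace F] {ι : Type*} {f : ι → E → F} {u : ι → ℝ}
    (hu : Summable u) {c : E} {r : ℝ} (hr : 0 < r)
    (hf : ∀ i, DifferentiableOn ℂ (f i) (ball c r)) (hfu : ∀ i, ∀ w ∈ ball c r, ‖f i w‖ ≤ u i) :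
    DifferentiableAt ℂ (fun w => ∑' i, f i w) c :=
  differentiableAt_of_tendstoUniformlyOn_ball hr
    (fun _ => .fun_sum fun i _ => hf i) (tendstoUniformlyOn_tsum hu hfu)

theorem norm_slope_sub_fderiv_le {f : E → F} {c v x : E} {r K : ℝ} {t : ℂ} (ht : t ≠ 0)
    (hf : DifferentiableOn ℂ f (ball c r))
    (hK : ∀ x ∈ ball c r, ∀ y ∈ ball c r, ‖fderiv ℂ f y - fderiv ℂ f x‖ ≤ K * ‖y - x‖)
    (hK₀ : 0 ≤ K) (hx : x ∈ ball c r) (hxt : x + t • v ∈ ball c r) :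
    ‖t⁻¹ • (f (x + t • v) - f x) - fderiv ℂ f x v‖ ≤ K * ‖v‖ ^ 2 * ‖t‖ := by
  let : NormedSpace ℝ E := NormedSpace.restrictScalars ℝ ℂ E
  have hseg : segment ℝ x (x + t • v) ⊆ ball c r := (convex_ball c r).segment_subset hx hxt
  have hmv := (convex_segment x (x + t • v)).norm_image_sub_le_of_norm_fderiv_le'
    (φ := fderiv ℂ f x) (C := K * ‖t • v‖)
    (fun y hy => hf.differentiableAt (isOpen_ball.mem_nhds (hseg hy)))
    (fun y hy => (hK x hx y (hseg hy)).trans ?_)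
    (left_mem_segment ℝ _ _) (right_mem_segment ℝ _ _)
  · rw [add_sub_cancel_left, map_smul] at hmv
    have ht' : ‖t‖ ≠ 0 := norm_ne_zero_iff.2 ht
    calc ‖t⁻¹ • (f (x + t • v) - f x) - fderiv ℂ f x v‖
        = ‖t‖⁻¹ * ‖f (x + t • v) - f x - t • fderiv ℂ f x v‖ := by
          rw [← norm_inv, ← norm_smul, smul_sub _ _ (t • _), inv_smul_smul₀ ht]
      _ ≤ ‖t‖⁻¹ * (K * ‖t • v‖ * ‖t • v‖) := by gcongr
      _ = K * ‖v‖ ^ 2 * ‖t‖ := by rw [norm_smul]; field_simp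
  · gcongr
    simpa [norm_sub_rev] using norm_sub_le_of_mem_segment hy

/-- The difference quotients in the direction `v` converge locally uniformly. -/
theorem differentiableOn_fderiv_apply [CompleteSpace F] {f : E → F} {U : Set E} (hU : IsOpen U)
    (hf : DifferentiableOn ℂ f U) (v : E) : DifferentiableOn ℂ (fun z => fderiv ℂ f z v) U := by
  intro c hc
  obtain ⟨r, hr, K, hK₀, hrU, hK⟩ := exists_norm_fderiv_sub_fderiv_le hU hf hc
  obtain ⟨δ, hδ, hδv⟩ := exists_pos_mul_lt (half_pos hr) ‖v‖
  obtain ⟨t, -, htδ, ht⟩ := exists_seq_strictAnti_tendsto' hδ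
  have hmem (k : ℕ) {x : E} (hx : x ∈ ball c (r / 2)) :
      x ∈ ball c r ∧ x + (t k : ℂ) • v ∈ ball c r := by
    have hshift : ‖(t k : ℂ) • v‖ ≤ ‖v‖ * δ := by
      rw [norm_smul, Complex.norm_of_nonneg (htδ k).1.le, mul_comm]
      gcongr
      exact (htδ k).2.le
    rw [mem_ball] at hx
    exact ⟨mem_ball.2 (by linarith), mem_ball.2 <|
      (dist_triangle _ x c).trans_lt (by rw [dist_self_add_left]; linarith)⟩
  have hdiff {x : E} (hx : x ∈ ball c r) : DifferentiableAt ℂ f x :=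
    hf.differentiableAt (hU.mem_nhds (hrU hx))
  refine (differentiableAt_of_tendstoUniformlyOn_ball (l := atTop) (half_pos hr)
    (f := fun k x => (t k : ℂ)⁻¹ • (f (x + (t k : ℂ) • v) - f x)) (fun k x hx => ?_) ?_
    ).differentiableWithinAt
  · have hshift : DifferentiableAt ℂ (fun x => f (x + (t k : ℂ) • v)) x :=
      (hdiff (hmem k hx).2).comp x (differentiableAt_id.add_const _)
    exact ((hshift.sub (hdiff (hmem k hx).1)).const_smul _).differentiableWithinAt
  · have hzero : Tendsto (fun k => K * ‖v‖ ^ 2 * ‖(t k : ℂ)‖) atTop (𝓝 0) := by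
      simpa using ht.norm.const_mul (K * ‖v‖ ^ 2)
    rw [Metric.tendstoUniformlyOn_iff]
    intro ε hε
    filter_upwards [hzero.eventually_lt_const hε] with k hk x hx
    rw [dist_eq_norm, norm_sub_rev]
    exact (norm_slope_sub_fderiv_le (Complex.ofReal_ne_zero.2 (htδ k).1.ne') (hf.mono hrU) hK hK₀
      (hmem k hx).1 (hmem k hx).2).trans_lt hk

theorem eqOn_zero_of_eventually_eq_zero_of_mem_ball [CompleteSpace F] {f : E → F} {c q : E} {r : ℝ}
    (hf : DifferentiableOn ℂ f (ball c r)) (hq : q ∈ ball c r) (h0 : ∀ᶠ w in 𝓝 q, f w = 0) :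
    EqOn f 0 (ball c r) := by
  intro w hw
  let : NormedSpace ℝ E := NormedSpace.restrictScalars ℝ ℂ E
  let line : ℂ → E := fun ζ => q + ζ • (w - q)
  have hline : Differentiable ℂ line := by fun_prop
  have hconv : Convex ℝ (line ⁻¹' ball c r) :=
    ((convex_ball c r).translate_preimage_right q).linear_preimage
      ((LinearMap.toSpanSingleton ℂ E (w - q)).restrictScalars ℝ)
  have hanalytic : AnalyticOnNhd ℂ (f ∘ line) (line ⁻¹' ball c r) :=
    (hf.comp hline.differentiableOn fun _ h => h).analyticOnNhd
      (isOpen_ball.preimage hline.continuous)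
  have hline0 : Tendsto line (𝓝 0) (𝓝 q) := by
    simpa [line] using hline.continuous.tendsto 0
  simpa [line] using hanalytic.eqOn_zero_of_preconnected_of_eventuallyEq_zero hconv.isPreconnected
    (z₀ := 0) (by simpa [line] using hq) (hline0.eventually h0)
    (show 1 ∈ line ⁻¹' ball c r by simpa [line] using hw)

theorem eqOn_zero_of_isPreconnected [CompleteSpace F] {f : E → F} {U : Set E} (hU : IsOpen U)
    (hUc : IsPreconnected U) (hf : DifferentiableOn ℂ f U) {q : E} (hq : q ∈ U)
    (h0 : ∀ᶠ w in 𝓝 q, f w = 0) : EqOn f 0 U := by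
  let W : Set E := {z | ∀ᶠ w in 𝓝 z, f w = 0}
  have hW : IsOpen W := isOpen_iff_mem_nhds.2 fun z hz => hz.eventually_nhds
  have hclosed : closure W ∩ U ⊆ W := by
    rintro p ⟨hp, hpU⟩
    obtain ⟨r, hr, hrU⟩ := Metric.isOpen_iff.1 hU p hpU
    obtain ⟨w, hw, hpw⟩ := Metric.mem_closure_iff.1 hp r hr
    filter_upwards [ball_mem_nhds p hr] with v hv
    exact eqOn_zero_of_eventually_eq_zero_of_mem_ball (hf.mono hrU) (mem_ball'.2 hpw) hw hv
  exact fun z hz => (hUc.subset_of_closure_inter_subset hW ⟨q, hq, h0⟩ hclosed hz).self_of_nhds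

theorem continuousOn_smul_fderiv_comp {T : Type*} [TopologicalSpace T] {k : T → ℂ}
    (hk : Continuous k) {A : T → E →L[ℂ] E} (hA : Continuous A) {f : E → F} {U : Set E}
    (hU : IsOpen U) (hf : DifferentiableOn ℂ f U) :
    ContinuousOn (fun p : E × T => k p.2 • (fderiv ℂ f (A p.2 p.1)).comp (A p.2))
      {p | A p.2 p.1 ∈ U} := by
  have hfderiv : ContinuousOn (fun p : E × T => fderiv ℂ f (A p.2 p.1)) {p | A p.2 p.1 ∈ U} :=
    (continuousOn_fderiv hU hf).comp (by fun_prop) fun p hp => hp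
  have hcomp : Continuous fun p : (E →L[ℂ] F) × (E →L[ℂ] E) => p.1.comp p.2 := by fun_prop
  exact (hk.comp continuous_snd).continuousOn.smul
    (hcomp.comp_continuousOn (hfderiv.prodMk (hA.comp continuous_snd).continuousOn))

theorem hasFDerivAt_integral_comp {T : Type*} [TopologicalSpace T] [CompactSpace T]
    [SecondCountableTopology T] [MeasurableSpace T] [BorelSpace T] {μ : Measure T}
    [IsFiniteMeasure μ] {k : T → ℂ} (hk : Continuous k) {A : T → E →L[ℂ] E} (hA : Continuous A)
    {f : E → F} {U : Set E} (hU : IsOpen U) (hf : DifferentiableOn ℂ f U) {z₀ : E}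
    (hz₀ : ∀ t, A t z₀ ∈ U) :
    HasFDerivAt (fun z => ∫ t, k t • f (A t z) ∂μ)
      (∫ t, k t • (fderiv ℂ f (A t z₀)).comp (A t) ∂μ) z₀ := by
  have hF' := continuousOn_smul_fderiv_comp hk hA hU hf
  have hcont {z : E} (hz : ∀ t, A t z ∈ U) : Continuous fun t => k t • f (A t z) :=
    hk.smul (hf.continuousOn.comp_continuous (by fun_prop) hz)
  have hcont' : Continuous fun t => k t • (fderiv ℂ f (A t z₀)).comp (A t) :=
    hF'.comp_continuous (f := fun t => (z₀, t)) (by fun_prop) hz₀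
  obtain ⟨M, hM⟩ := isCompact_univ.exists_bound_of_continuousOn hcont'.continuousOn
  have hnear : ∀ᶠ z in 𝓝 z₀, ∀ t ∈ univ,
      A t z ∈ U ∧ ‖k t • (fderiv ℂ f (A t z)).comp (A t)‖ < M + 1 := by
    refine isCompact_univ.eventually_forall_of_forall_eventually fun t ht => ?_
    have hpre : {p : E × T | A p.2 p.1 ∈ U} ∈ 𝓝 (z₀, t) :=
      (hU.preimage (by fun_prop)).mem_nhds (hz₀ t)
    exact Filter.Eventually.and hpre ((hF'.continuousAt hpre).norm.eventually_lt_const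
      ((hM t ht).trans_lt (lt_add_one M)))
  refine hasFDerivAt_integral_of_dominated_of_fderiv_le
    (F' := fun z t => k t • (fderiv ℂ f (A t z)).comp (A t)) (bound := fun _ => M + 1) hnear
    ?_ ?_ hcont'.aestronglyMeasurable ?_ (integrable_const _) ?_
  · exact hnear.mono fun z hz => (hcont fun t => (hz t (mem_univ t)).1).aestronglyMeasurable
  · exact (hcont hz₀).integrable_of_hasCompactSupport (.of_compactSpace _)
  · exact .of_forall fun t z hz => (hz t (mem_univ t)).2.le
  · exact .of_forall fun t z hz => ((hf.differentiableAt
      (hU.mem_nhds (hz t (mem_univ t)).1)).hasFDerivAt.comp z (A t).hasFDerivAt).const_smul _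

end Holomorphic

/-! ### Rotations, Laurent monomials and homogeneous components -/

section Torus

variable {ι : Type*}

/-- The action of the torus on `ℂ^ι` by rotations of the coordinates. -/
noncomputable def rot (t : UnitAddTorus ι) : (ι → ℂ) →L[ℂ] (ι → ℂ) :=
  ContinuousLinearMap.pi fun i => fourier 1 (t i) • ContinuousLinearMap.proj i

@[simp]
theorem rot_apply (t : UnitAddTorus ι) (z : ι → ℂ) (i : ι) : rot t z i = fourier 1 (t i) * z i :=
  rfl

theorem rot_zero (z : ι → ℂ) : rot 0 z = z := by
  ext i
  simp

theorem rot_rot (s t : UnitAddTorus ι) (z : ι → ℂ) : rot s (rot t z) = rot (s + t) z := by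
  ext i
  simp [AddCircle.toCircle_add, mul_assoc]

theorem rot_single [DecidableEq ι] (t : UnitAddTorus ι) (j : ι) (c : ℂ) :
    rot t (Pi.single j c) = (fourier 1 (t j) : ℂ) • Pi.single j c := by
  ext i
  obtain rfl | hi := eq_or_ne i j
  · simp
  · simp [hi]

theorem hasDerivAt_rot_single [DecidableEq ι] (z : ι → ℂ) (j : ι) :
    HasDerivAt (fun x : ℝ => rot (Pi.single j (x : UnitAddCircle)) z)
      ((2 * Real.pi * Complex.I * z j) • Pi.single j (1 : ℂ)) 0 := by
  rw [hasDerivAt_pi]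
  intro i
  obtain rfl | hi := eq_or_ne i j
  · simpa using (hasDerivAt_fourier 1 1 (0 : ℝ)).mul_const (z i)
  · simpa [hi] using hasDerivAt_const (0 : ℝ) (z i)

theorem dense_forall_ne_zero : Dense {z : ι → ℂ | ∀ i, z i ≠ 0} := by
  have hpi : {z : ι → ℂ | ∀ i, z i ≠ 0} = univ.pi fun _ => ({0}ᶜ : Set ℂ) := by
    ext z
    simp
  rw [hpi]
  exact dense_pi _ fun i _ => dense_compl_singleton 0

theorem closure_subset_closure_inter_forall_ne_zero {G : Set (ι → ℂ)} (hG : IsOpen G) :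
    closure G ⊆ closure (G ∩ {z | ∀ i, z i ≠ 0}) :=
  closure_minimal (dense_forall_ne_zero.open_subset_closure_inter hG) isClosed_closure

theorem isOpen_forall_ne_zero [Finite ι] : IsOpen {z : ι → ℂ | ∀ i, z i ≠ 0} := by
  simp only [ofPred_forall]
  exact isOpen_iInter_of_finite fun i => isOpen_ne_fun (continuous_apply i) continuous_const

theorem continuous_rot [Finite ι] :
    Continuous (rot : UnitAddTorus ι → (ι → ℂ) →L[ℂ] (ι → ℂ)) := by
  cases nonempty_fintype ι
  refine continuous_clm_apply.2 fun z => continuous_pi fun i => ?_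
  simp only [rot_apply]
  fun_prop

variable [Fintype ι]

theorem norm_mFourier_apply (α : ι → ℤ) (t : UnitAddTorus ι) : ‖mFourier α t‖ = 1 := by
  simp only [mFourier, ContinuousMap.coe_mk, norm_prod, fourier_apply, Circle.norm_coe,
    Finset.prod_const_one]

theorem mFourier_ne_zero (α : ι → ℤ) (t : UnitAddTorus ι) : mFourier α t ≠ 0 :=
  norm_ne_zero_iff.1 (by simp [norm_mFourier_apply])

theorem mFourier_apply_add (α : ι → ℤ) (s t : UnitAddTorus ι) :
    mFourier α (s + t) = mFourier α s * mFourier α t := by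
  simp only [mFourier, ContinuousMap.coe_mk, ← Finset.prod_mul_distrib, Pi.add_apply,
    fourier_apply, smul_add, AddCircle.toCircle_add, Circle.coe_mul]

theorem mFourier_apply_single [DecidableEq ι] (α : ι → ℤ) (j : ι) (x : UnitAddCircle) :
    mFourier α (Pi.single j x) = fourier (α j) x := by
  simp only [mFourier, ContinuousMap.coe_mk]
  rw [Finset.prod_eq_single j (fun i _ hi => by simp [hi]) (by simp), Pi.single_eq_same]

/-- The Laurent monomial `z^α`. By the convention `0⁻¹ = 0` it is `0` where it has a pole. -/
noncomputable def laurentMonomial (α : ι → ℤ) (z : ι → ℂ) : ℂ := ∏ i, z i ^ α i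

theorem laurentMonomial_rot (α : ι → ℤ) (t : UnitAddTorus ι) (z : ι → ℂ) :
    laurentMonomial α (rot t z) = mFourier α t * laurentMonomial α z := by
  simp only [laurentMonomial, rot_apply, mul_zpow, Finset.prod_mul_distrib, mFourier,
    ContinuousMap.coe_mk, fourier_apply, one_smul, AddCircle.toCircle_zsmul, Circle.coe_zpow]

theorem laurentMonomial_ne_zero {α : ι → ℤ} {z : ι → ℂ} (hz : ∀ i, α i = 0 ∨ z i ≠ 0) :
    laurentMonomial α z ≠ 0 :=
  Finset.prod_ne_zero_iff.2 fun i _ => (hz i).elim (fun h => by simp [h]) (zpow_ne_zero _)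

theorem laurentMonomial_eq_zero {α : ι → ℤ} {z : ι → ℂ} {j : ι} (hα : α j ≠ 0) (hz : z j = 0) :
    laurentMonomial α z = 0 :=
  Finset.prod_eq_zero (Finset.mem_univ j) (by rw [hz, zero_zpow _ hα])

theorem laurentMonomial_add {α β : ι → ℤ} {z : ι → ℂ}
    (hz : ∀ i, z i ≠ 0 ∨ α i + β i ≠ 0 ∨ α i = 0 ∧ β i = 0) :
    laurentMonomial (α + β) z = laurentMonomial α z * laurentMonomial β z := by
  simp only [laurentMonomial, ← Finset.prod_mul_distrib, Pi.add_apply]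
  exact Finset.prod_congr rfl fun i _ => zpow_add' (hz i)

theorem laurentMonomial_negPart_mul {α : ι → ℤ} {z : ι → ℂ} (hz : ∀ i, z i ≠ 0) :
    laurentMonomial α⁻ z * laurentMonomial α z = laurentMonomial α⁺ z := by
  rw [← laurentMonomial_add fun i => .inl (hz i), add_comm,
    ← sub_eq_iff_eq_add.1 (posPart_sub_negPart α)]

theorem laurentMonomial_single_one [DecidableEq ι] (j : ι) (z : ι → ℂ) :
    laurentMonomial (Pi.single j 1) z = z j := by
  rw [laurentMonomial, Finset.prod_eq_single j (fun i _ hi => by simp [hi]) (by simp),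
    Pi.single_eq_same, zpow_one]

theorem differentiableAt_laurentMonomial {α : ι → ℤ} {z : ι → ℂ}
    (hz : ∀ i, 0 ≤ α i ∨ z i ≠ 0) : DifferentiableAt ℂ (laurentMonomial α) z := by
  classical
  exact (HasFDerivAt.finsetProd fun i _ =>
    ((differentiableAt_apply i z).zpow (hz i).symm).hasFDerivAt).differentiableAt

theorem differentiable_laurentMonomial_negPart (α : ι → ℤ) :
    Differentiable ℂ (laurentMonomial α⁻) := fun _ =>
  differentiableAt_laurentMonomial fun i => .inl (negPart_nonneg α i)

theorem differentiable_laurentMonomial_posPart (α : ι → ℤ) :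
    Differentiable ℂ (laurentMonomial α⁺) := fun _ =>
  differentiableAt_laurentMonomial fun i => .inl (posPart_nonneg α i)

/-- The normalised Haar measure on the torus. -/
noncomputable def torusMeasure (ι : Type*) [Fintype ι] : Measure (UnitAddTorus ι) :=
  Measure.pi fun _ => AddCircle.haarAddCircle

instance : IsProbabilityMeasure (torusMeasure ι) := by
  unfold torusMeasure
  infer_instance

instance : (torusMeasure ι).IsAddRightInvariant := by
  unfold torusMeasure
  infer_instance

/-- The homogeneous component of `f` of multidegree `α`: at `z` it is the Fourier coefficient of
`f` on the torus through `z`. -/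
noncomputable def torusCoeff (f : (ι → ℂ) → ℂ) (α : ι → ℤ) (z : ι → ℂ) : ℂ :=
  mFourierCoeff (fun t => f (rot t z)) α

theorem torusCoeff_eq_integral (f : (ι → ℂ) → ℂ) (α : ι → ℤ) (z : ι → ℂ) :
    torusCoeff f α z = ∫ t, mFourier (-α) t • f (rot t z) ∂torusMeasure ι := rfl

theorem torusCoeff_rot (f : (ι → ℂ) → ℂ) (α : ι → ℤ) (s : UnitAddTorus ι) (z : ι → ℂ) :
    torusCoeff f α (rot s z) = mFourier α s * torusCoeff f α z := by
  have hinv (t : UnitAddTorus ι) :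
      mFourier (-α) t = mFourier α s * mFourier (-α) (t + s) := by
    rw [mFourier_apply_add, mul_left_comm, ← mFourier_add, add_neg_cancel, mFourier_zero,
      ContinuousMap.one_apply, mul_one]
  rw [torusCoeff_eq_integral, torusCoeff_eq_integral, ← integral_const_mul,
    ← integral_add_right_eq_self (fun t => mFourier α s * (mFourier (-α) t • f (rot t z))) s]
  simp only [rot_rot, smul_eq_mul, ← mul_assoc, ← hinv]

theorem norm_torusCoeff_le {f : (ι → ℂ) → ℂ} {α : ι → ℤ} {z : ι → ℂ} {M : ℝ}
    (hM : ∀ t, ‖f (rot t z)‖ ≤ M) : ‖torusCoeff f α z‖ ≤ M := by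
  rw [torusCoeff_eq_integral]
  refine (norm_integral_le_of_norm_le_const (.of_forall fun t => ?_)).trans_eq
    (by rw [probReal_univ, mul_one])
  rw [norm_smul, norm_mFourier_apply, one_mul]
  exact hM t

end Torus

/-! ### Laurent coefficients -/

section LaurentCoeff

variable {n : ℕ} {G : Set (Fin n → ℂ)} {f : (Fin n → ℂ) → ℂ} {α : Fin n → ℤ} {a : ℂ}

theorem IsCircled.rot_mem (hc : IsCircled G) (t : UnitAddTorus (Fin n)) {z : Fin n → ℂ}
    (hz : z ∈ G) : rot t z ∈ G := by
  have hcoe (i : Fin n) : ∃ x : ℝ, (x : UnitAddCircle) = t i := QuotientAddGroup.mk_surjective _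
  choose x hx using hcoe
  convert hc z hz (fun i => 2 * Real.pi * x i) using 2 with i
  rw [rot_apply, ← hx i, fourier_coe_apply]
  congr 2
  push_cast
  ring

theorem holomorphicOn_partialDeriv (hG : IsOpen G) (hf : f ∈ holomorphicOn G) (j : Fin n) :
    partialDeriv j f ∈ holomorphicOn G :=
  differentiableOn_fderiv_apply hG hf _

theorem hasFDerivAt_torusCoeff (hG : IsOpen G) (hc : IsCircled G) (hf : f ∈ holomorphicOn G)
    (α : Fin n → ℤ) {z : Fin n → ℂ} (hz : z ∈ G) :
    HasFDerivAt (torusCoeff f α)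
      (∫ t, mFourier (-α) t • (fderiv ℂ f (rot t z)).comp (rot t) ∂torusMeasure (Fin n)) z :=
  hasFDerivAt_integral_comp (μ := torusMeasure (Fin n)) (by fun_prop) continuous_rot hG hf
    fun t => hc.rot_mem t hz

theorem holomorphicOn_torusCoeff (hG : IsOpen G) (hc : IsCircled G) (hf : f ∈ holomorphicOn G)
    (α : Fin n → ℤ) : torusCoeff f α ∈ holomorphicOn G := fun _ hz =>
  (hasFDerivAt_torusCoeff hG hc hf α hz).differentiableAt.differentiableWithinAt

theorem partialDeriv_torusCoeff (hG : IsOpen G) (hc : IsCircled G) (hf : f ∈ holomorphicOn G)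
    (α : Fin n → ℤ) (j : Fin n) {z : Fin n → ℂ} (hz : z ∈ G) :
    partialDeriv j (torusCoeff f α) z = torusCoeff (partialDeriv j f) (α - Pi.single j 1) z := by
  have hcont : Continuous fun t => mFourier (-α) t • (fderiv ℂ f (rot t z)).comp (rot t) :=
    (continuousOn_smul_fderiv_comp (by fun_prop) continuous_rot hG hf).comp_continuous
      (f := fun t => (z, t)) (by fun_prop) fun t => hc.rot_mem t hz
  have hint : Integrable (fun t => mFourier (-α) t • (fderiv ℂ f (rot t z)).comp (rot t))
      (torusMeasure (Fin n)) :=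
    hcont.integrable_of_hasCompactSupport (.of_compactSpace _)
  have hfourier (t : UnitAddTorus (Fin n)) :
      mFourier (-(α - Pi.single j 1)) t = mFourier (-α) t * fourier 1 (t j) := by
    rw [neg_sub, sub_eq_neg_add, mFourier_add, mFourier_single]
  rw [partialDeriv, (hasFDerivAt_torusCoeff hG hc hf α hz).fderiv,
    ContinuousLinearMap.integral_apply hint, torusCoeff_eq_integral]
  simp only [smul_apply, ContinuousLinearMap.comp_apply, rot_single, map_smul, hfourier,
    partialDeriv, smul_smul]

/-- Euler's relation: differentiate `g` along the rotations of the `j`-th coordinate. -/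
theorem mul_partialDeriv_of_rot {g : (Fin n → ℂ) → ℂ} {z : Fin n → ℂ}
    (hg : DifferentiableAt ℂ g z) (hrot : ∀ t, g (rot t z) = mFourier α t * g z) (j : Fin n) :
    z j * partialDeriv j g z = α j * g z := by
  have hγ := hasDerivAt_rot_single z j
  set γ : ℝ → Fin n → ℂ := fun x => rot (Pi.single j (x : UnitAddCircle)) z
  have hγ0 : γ 0 = z := by simp [γ, rot_zero]
  have hchain : HasDerivAt (g ∘ γ)
      (fderiv ℂ g z ((2 * Real.pi * Complex.I * z j) • Pi.single j (1 : ℂ))) 0 :=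
    (hγ0.symm ▸ hg.hasFDerivAt.restrictScalars ℝ :
      HasFDerivAt g ((fderiv ℂ g z).restrictScalars ℝ) (γ 0)).comp_hasDerivAt 0 hγ
  have hfourier : HasDerivAt (g ∘ γ) (2 * Real.pi * Complex.I * α j * g z) 0 := by
    have hgγ : g ∘ γ = fun x : ℝ => fourier (α j) (x : UnitAddCircle) * g z := by
      ext x
      rw [Function.comp_apply, hrot, mFourier_apply_single]
    rw [hgγ]
    simpa using (hasDerivAt_fourier 1 (α j) (0 : ℝ)).mul_const (g z)
  have heq := hchain.unique hfourier
  rw [map_smul, smul_eq_mul, mul_assoc, mul_assoc _ (α j : ℂ)] at heq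
  exact mul_left_cancel₀ Complex.two_pi_I_ne_zero heq

theorem fderiv_eq_zero_of_rot_invariant {g : (Fin n → ℂ) → ℂ} {z : Fin n → ℂ}
    (hg : DifferentiableAt ℂ g z) (hrot : ∀ t, g (rot t z) = g z) (hz : ∀ i, z i ≠ 0) :
    fderiv ℂ g z = 0 := by
  have hpartial (j : Fin n) : partialDeriv j g z = 0 := by
    have heuler := mul_partialDeriv_of_rot (α := 0) hg (by simpa [mFourier_zero] using hrot) j
    simpa [hz j] using heuler
  refine ContinuousLinearMap.coe_injective (LinearMap.pi_ext' fun j => LinearMap.ext_ring ?_)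
  exact hpartial j

theorem torusCoeff_eventually_eq (hG : IsOpen G) (hc : IsCircled G) (hf : f ∈ holomorphicOn G)
    (α : Fin n → ℤ) {z₀ : Fin n → ℂ} (hz₀ : z₀ ∈ G) (h0 : ∀ i, z₀ i ≠ 0) :
    ∃ a : ℂ, ∀ᶠ z in 𝓝 z₀, torusCoeff f α z = a * laurentMonomial α z := by
  obtain ⟨r, hr, hrG⟩ := Metric.isOpen_iff.1 (hG.inter isOpen_forall_ne_zero) z₀ ⟨hz₀, h0⟩
  have hmono {z : Fin n → ℂ} (hz : z ∈ ball z₀ r) : laurentMonomial α z ≠ 0 :=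
    laurentMonomial_ne_zero fun i => .inr ((hrG hz).2 i)
  let q (z : Fin n → ℂ) : ℂ := torusCoeff f α z / laurentMonomial α z
  have hq {z : Fin n → ℂ} (hz : z ∈ ball z₀ r) : DifferentiableAt ℂ q z := by
    simp only [q, div_eq_mul_inv]
    exact (hasFDerivAt_torusCoeff hG hc hf α (hrG hz).1).differentiableAt.mul
      ((differentiableAt_laurentMonomial fun i => .inr ((hrG hz).2 i)).inv (hmono hz))
  have hrot (z : Fin n → ℂ) (t : UnitAddTorus (Fin n)) : q (rot t z) = q z := by
    simp only [q, torusCoeff_rot, laurentMonomial_rot]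
    exact mul_div_mul_left _ _ (mFourier_ne_zero α t)
  have hconst {z : Fin n → ℂ} (hz : z ∈ ball z₀ r) : q z₀ = q z :=
    isOpen_ball.is_const_of_fderiv_eq_zero (convex_ball z₀ r).isPreconnected
      (fun z hz => (hq hz).differentiableWithinAt)
      (fun z hz => fderiv_eq_zero_of_rot_invariant (hq hz) (hrot z) (hrG hz).2)
      (mem_ball_self hr) hz
  refine ⟨q z₀, ?_⟩
  filter_upwards [ball_mem_nhds z₀ hr] with z hz
  rw [hconst hz, div_mul_cancel₀ _ (hmono hz)]

/-- `a` is the coefficient of `z^α` in the Laurent expansion of `f` on `G`. Coordinate hyperplanes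
are left out because a monomial with a pole there has the junk value `0`. -/
def IsLaurentCoeff (G : Set (Fin n → ℂ)) (f : (Fin n → ℂ) → ℂ) (α : Fin n → ℤ) (a : ℂ) : Prop :=
  ∀ z ∈ G, (∀ i, z i ≠ 0) → torusCoeff f α z = a * laurentMonomial α z

theorem exists_isLaurentCoeff (hG : IsComplexDomain G) (hc : IsCircled G)
    (hf : f ∈ holomorphicOn G) (α : Fin n → ℤ) : ∃ a, IsLaurentCoeff G f α a := by
  obtain ⟨z₀, hz₀, h0⟩ := dense_forall_ne_zero.inter_open_nonempty G hG.1 hG.2.nonempty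
  obtain ⟨a, ha⟩ := torusCoeff_eventually_eq hG.1 hc hf α hz₀ h0
  let d (z : Fin n → ℂ) : ℂ :=
    laurentMonomial α⁻ z * torusCoeff f α z - a * laurentMonomial α⁺ z
  have hd : DifferentiableOn ℂ d G :=
    ((differentiable_laurentMonomial_negPart α).differentiableOn.mul
      (holomorphicOn_torusCoeff hG.1 hc hf α)).sub
      ((differentiable_laurentMonomial_posPart α).const_mul a).differentiableOn
  have hd0 : ∀ᶠ z in 𝓝 z₀, d z = 0 := by
    filter_upwards [ha, isOpen_forall_ne_zero.mem_nhds h0] with z hz hz0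
    simp only [d]
    rw [hz, ← laurentMonomial_negPart_mul hz0]
    ring
  refine ⟨a, fun z hz hz0 => ?_⟩
  have hdz : d z = 0 := eqOn_zero_of_isPreconnected hG.1 hG.2.isPreconnected hd hz₀ hd0 hz
  simp only [d, sub_eq_zero] at hdz
  rw [← laurentMonomial_negPart_mul hz0, mul_left_comm] at hdz
  exact mul_left_cancel₀ (laurentMonomial_ne_zero fun i => .inr (hz0 i)) hdz

theorem IsLaurentCoeff.laurentMonomial_negPart_mul_torusCoeff (ha : IsLaurentCoeff G f α a)
    (hG : IsOpen G) (hc : IsCircled G) (hf : f ∈ holomorphicOn G) {z : Fin n → ℂ} (hz : z ∈ G) :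
    laurentMonomial α⁻ z * torusCoeff f α z = a * laurentMonomial α⁺ z := by
  have heq : EqOn (fun z => laurentMonomial α⁻ z * torusCoeff f α z)
      (fun z => a * laurentMonomial α⁺ z) (G ∩ {z | ∀ i, z i ≠ 0}) := by
    rintro w ⟨hw, hw0⟩
    simp only [ha w hw hw0, ← laurentMonomial_negPart_mul hw0]
    ring
  refine heq.of_subset_closure ?_ ?_ inter_subset_left
    (dense_forall_ne_zero.open_subset_closure_inter hG) hz
  · exact (differentiable_laurentMonomial_negPart α).continuous.continuousOn.mul
      (holomorphicOn_torusCoeff hG hc hf α).continuousOn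
  · exact ((differentiable_laurentMonomial_posPart α).continuous.const_mul a).continuousOn

theorem IsLaurentCoeff.eq_zero_of_mem (ha : IsLaurentCoeff G f α a) (hG : IsOpen G)
    (hc : IsCircled G) (hf : f ∈ holomorphicOn G) {p : Fin n → ℂ} (hp : p ∈ G) {j : Fin n}
    (hpj : p j = 0) (hα : α j < 0) : a = 0 := by
  obtain ⟨w, hw, hw0⟩ := dense_forall_ne_zero.inter_open_nonempty
    ((fun w => Function.update w j 0) ⁻¹' G) (hG.preimage (by fun_prop))
    ⟨p, by rwa [mem_preimage, ← hpj, Function.update_eq_self]⟩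
  have heq := ha.laurentMonomial_negPart_mul_torusCoeff hG hc hf hw
  rw [laurentMonomial_eq_zero (j := j) (by simpa using hα) (Function.update_self ..), zero_mul,
    zero_eq_mul] at heq
  refine heq.resolve_right (laurentMonomial_ne_zero fun i => ?_)
  obtain rfl | hi := eq_or_ne i j
  · exact .inl (by simpa using hα.le)
  · exact .inr (by simpa [hi] using hw0 i)

theorem IsLaurentCoeff.partialDeriv (ha : IsLaurentCoeff G f α a) (hG : IsOpen G)
    (hc : IsCircled G) (hf : f ∈ holomorphicOn G) (j : Fin n) :
    IsLaurentCoeff G (partialDeriv j f) (α - Pi.single j 1) (α j * a) := by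
  intro z hz hz0
  have heuler := mul_partialDeriv_of_rot (hasFDerivAt_torusCoeff hG hc hf α hz).differentiableAt
    (fun t => torusCoeff_rot f α t z) j
  have hmono : laurentMonomial α z = laurentMonomial (α - Pi.single j 1) z * z j := by
    rw [← laurentMonomial_single_one j z, ← laurentMonomial_add fun i => .inl (hz0 i),
      sub_add_cancel]
  rw [← partialDeriv_torusCoeff hG hc hf α j hz]
  apply mul_left_cancel₀ (hz0 j)
  rw [heuler, ha z hz hz0, hmono]
  ring

end LaurentCoeff

/-! ### The logarithmic image -/

section LogImage

variable {ι : Type*}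

/-- The coordinatewise logarithm of the absolute value. It describes `z` up to rotation only if
all coordinates are nonzero, since `Real.log 0 = 0`. -/
noncomputable def logNorm (z : ι → ℂ) : ι → ℝ := fun i => Real.log ‖z i‖

/-- The point of the positive orthant with prescribed logarithm. -/
noncomputable def expPoint (x : ι → ℝ) : ι → ℂ := fun i => (Real.exp (x i) : ℂ)

/-- The logarithmic image of `G`, read off from the points of `G` in the positive orthant; for a
circled set these represent all points with nonzero coordinates. -/
def logSet (G : Set (ι → ℂ)) : Set (ι → ℝ) := expPoint ⁻¹' G

/-- The Reinhardt set over `Y`: the points with nonzero coordinates whose logarithmic image lies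
in `Y`. -/
def logPreimage (Y : Set (ι → ℝ)) : Set (ι → ℂ) := {z | (∀ i, z i ≠ 0) ∧ logNorm z ∈ Y}

theorem expPoint_ne_zero (x : ι → ℝ) (i : ι) : expPoint x i ≠ 0 :=
  Complex.ofReal_ne_zero.2 (Real.exp_ne_zero _)

theorem norm_expPoint_apply (x : ι → ℝ) (i : ι) : ‖expPoint x i‖ = Real.exp (x i) := by
  rw [expPoint, Complex.norm_real, Real.norm_of_nonneg (Real.exp_pos _).le]

theorem logNorm_expPoint (x : ι → ℝ) : logNorm (expPoint x) = x := by
  ext i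
  rw [logNorm, norm_expPoint_apply, Real.log_exp]

theorem expPoint_mem_logPreimage {Y : Set (ι → ℝ)} {y : ι → ℝ} (hy : y ∈ Y) :
    expPoint y ∈ logPreimage Y :=
  ⟨expPoint_ne_zero y, by rwa [logNorm_expPoint]⟩

theorem exists_rot_expPoint_logNorm {z : ι → ℂ} (hz : ∀ i, z i ≠ 0) :
    ∃ t, rot t (expPoint (logNorm z)) = z := by
  refine ⟨fun i => ((z i).arg / (2 * Real.pi) : ℝ), funext fun i => ?_⟩
  rw [rot_apply, fourier_coe_apply, expPoint, logNorm, Real.exp_log (norm_pos_iff.2 (hz i)),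
    mul_comm]
  refine Eq.trans ?_ (Complex.norm_mul_exp_arg_mul_I (z i))
  congr 2
  push_cast
  field_simp

theorem continuous_expPoint : Continuous (expPoint : (ι → ℝ) → ι → ℂ) := by
  unfold expPoint
  fun_prop

theorem isOpen_logSet {G : Set (ι → ℂ)} (hG : IsOpen G) : IsOpen (logSet G) :=
  hG.preimage continuous_expPoint

theorem continuousAt_logNorm {z : ι → ℂ} (hz : ∀ i, z i ≠ 0) : ContinuousAt logNorm z :=
  continuousAt_pi.2 fun i =>
    (continuous_apply i).continuousAt.norm.log (norm_ne_zero_iff.2 (hz i))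

theorem logPreimage_eq_image_exp (Y : Set (ι → ℝ)) :
    logPreimage Y =
      (fun w i => Complex.exp (w i)) '' {w : ι → ℂ | (fun i => (w i).re) ∈ Y} := by
  ext z
  constructor
  · rintro ⟨hz, hzY⟩
    refine ⟨fun i => Complex.log (z i), ?_, funext fun i => Complex.exp_log (hz i)⟩
    simp only [mem_ofPred_eq, Complex.log_re]
    exact hzY
  · rintro ⟨w, hw, rfl⟩
    refine ⟨fun i => Complex.exp_ne_zero _, ?_⟩
    have hre : logNorm (fun i => Complex.exp (w i)) = fun i => (w i).re := by
      ext i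
      rw [logNorm, Complex.norm_exp, Real.log_exp]
    rwa [hre]

theorem isConnected_logPreimage {Y : Set (ι → ℝ)} (hY : Convex ℝ Y) (hne : Y.Nonempty) :
    IsConnected (logPreimage Y) := by
  obtain ⟨y, hy⟩ := hne
  refine ⟨⟨_, expPoint_mem_logPreimage hy⟩, ?_⟩
  have hre : Convex ℝ {w : ι → ℂ | (fun i => (w i).re) ∈ Y} :=
    hY.linear_preimage (LinearMap.pi fun i => Complex.reLm ∘ₗ LinearMap.proj i)
  rw [logPreimage_eq_image_exp]
  exact hre.isPreconnected.image _ (by fun_prop)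

theorem isOpen_logPreimage [Finite ι] {Y : Set (ι → ℝ)} (hY : IsOpen Y) :
    IsOpen (logPreimage Y) := by
  rw [isOpen_iff_mem_nhds]
  rintro z ⟨hz, hzY⟩
  exact (isOpen_forall_ne_zero.eventually_mem hz).and
    ((continuousAt_logNorm hz).eventually_mem (hY.mem_nhds hzY))

theorem isComplexDomain_logPreimage {n : ℕ} {Y : Set (Fin n → ℝ)} (hYo : IsOpen Y)
    (hYc : Convex ℝ Y) (hne : Y.Nonempty) : IsComplexDomain (logPreimage Y) :=
  ⟨isOpen_logPreimage hYo, isConnected_logPreimage hYc hne⟩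

theorem norm_laurentMonomial [Fintype ι] (α : ι → ℤ) {z : ι → ℂ} (hz : ∀ i, z i ≠ 0) :
    ‖laurentMonomial α z‖ = Real.exp (∑ i, α i * logNorm z i) := by
  rw [laurentMonomial, norm_prod, Real.exp_sum]
  refine Finset.prod_congr rfl fun i _ => ?_
  rw [norm_zpow, mul_comm, Real.exp_mul, logNorm, Real.exp_log (norm_pos_iff.2 (hz i)),
    Real.rpow_intCast]

end LogImage

/-! ### Convergence of Laurent series -/

section Convergence

variable {ι : Type*} [Fintype ι] {a : (ι → ℤ) → ℂ} {Y : Set (ι → ℝ)}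

/-- The terms of the Laurent series with coefficients `a` are bounded on the torus over `x`. -/
def CoeffBounded (a : (ι → ℤ) → ℂ) (x : ι → ℝ) : Prop :=
  ∃ C : ℝ, ∀ α, ‖a α‖ * Real.exp (∑ i, α i * x i) ≤ C

theorem convex_setOf_coeffBounded (a : (ι → ℤ) → ℂ) : Convex ℝ {x | CoeffBounded a x} := by
  rintro x ⟨C, hC⟩ y ⟨D, hD⟩ s t hs ht hst
  have hconv (α : ι → ℤ) :
      ConvexOn ℝ univ fun x : ι → ℝ => ‖a α‖ * Real.exp (∑ i, α i * x i) := by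
    have hexp : ConvexOn ℝ univ fun x : ι → ℝ => Real.exp (∑ i, α i * x i) := by
      simpa [Function.comp_def] using
        convexOn_exp.comp_linearMap (∑ i, (α i : ℝ) • (LinearMap.proj i : (ι → ℝ) →ₗ[ℝ] ℝ))
    exact hexp.smul (norm_nonneg (a α))
  exact ⟨s • C + t • D, fun α => ((hconv α).2 (mem_univ x) (mem_univ y) hs ht hst).trans
    (add_le_add (smul_le_smul_of_nonneg_left (hC α) hs)
      (smul_le_smul_of_nonneg_left (hD α) ht))⟩

theorem summable_prod_apply {κ : Type*} {g : ι → κ → ℝ} (hg0 : ∀ i k, 0 ≤ g i k)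
    (hg : ∀ i, Summable (g i)) : Summable fun α : ι → κ => ∏ i, g i (α i) := by
  classical
  refine summable_of_sum_le (c := ∏ i, ∑' k, g i k)
    (fun α => Finset.prod_nonneg fun i _ => hg0 i _) fun u => ?_
  have hu : u ⊆ Fintype.piFinset fun i => u.image fun α => α i := fun α hα =>
    Fintype.mem_piFinset.2 fun i => Finset.mem_image_of_mem _ hα
  calc ∑ α ∈ u, ∏ i, g i (α i)
      ≤ ∑ α ∈ Fintype.piFinset fun i => u.image fun α => α i, ∏ i, g i (α i) :=
        Finset.sum_le_sum_of_subset_of_nonneg hu fun α _ _ =>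
          Finset.prod_nonneg fun i _ => hg0 i _
    _ = ∏ i, ∑ k ∈ u.image fun α => α i, g i k := (Finset.prod_univ_sum _ _).symm
    _ ≤ ∏ i, ∑' k, g i k :=
        Finset.prod_le_prod (fun i _ => Finset.sum_nonneg fun k _ => hg0 i k)
          fun i _ => (hg i).sum_le_tsum _ fun k _ => hg0 i k

theorem summable_exp_neg_mul_sum_abs {δ : ℝ} (hδ : 0 < δ) :
    Summable fun α : ι → ℤ => Real.exp (-δ * ∑ i, |(α i : ℝ)|) := by
  have hnat : Summable fun m : ℕ => Real.exp (-δ * |((m : ℤ) : ℝ)|) :=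
    (Real.summable_exp_nat_mul_iff.2 (neg_neg_of_pos hδ)).congr fun m => by simp [mul_comm]
  have hint : Summable fun m : ℤ => Real.exp (-δ * |(m : ℝ)|) :=
    .of_nat_of_neg hnat (by simpa using hnat)
  simp only [Finset.mul_sum, Real.exp_sum]
  exact summable_prod_apply (g := fun _ (m : ℤ) => Real.exp (-δ * |(m : ℝ)|))
    (fun _ _ => (Real.exp_pos _).le) fun _ => hint

/-- Compare with the vertex of a cube around `y` in the direction of the signs of `α`. -/
theorem exists_norm_mul_exp_add_le (hY : IsOpen Y) (ha : ∀ y ∈ Y, CoeffBounded a y) {y : ι → ℝ}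
    (hy : y ∈ Y) : ∃ δ > 0, ∃ C, ∀ α : ι → ℤ,
      ‖a α‖ * Real.exp (∑ i, α i * y i + δ * ∑ i, |(α i : ℝ)|) ≤ C := by
  obtain ⟨δ, hδ, hδY⟩ := nhds_basis_closedBall.mem_iff.1 (hY.mem_nhds hy)
  have hvertex (σ : ι → SignType) : (fun i => y i + δ * (σ i : ℝ)) ∈ Y := by
    refine hδY ((dist_pi_le_iff hδ.le).2 fun i => ?_)
    rw [Real.dist_eq, add_sub_cancel_left, abs_mul, abs_of_pos hδ]
    refine mul_le_of_le_one_right hδ.le ?_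
    cases σ i <;> simp
  choose C hC using fun σ => ha _ (hvertex σ)
  obtain ⟨M, hM⟩ := Finite.bddAbove_range C
  refine ⟨δ, hδ, M, fun α => ?_⟩
  refine le_trans (le_of_eq ?_) ((hC (fun i => SignType.sign (α i : ℝ)) α).trans (hM ⟨_, rfl⟩))
  congr 2
  rw [Finset.mul_sum, ← Finset.sum_add_distrib]
  refine Finset.sum_congr rfl fun i _ => ?_
  rw [← self_mul_sign (α i : ℝ)]
  ring

theorem sum_mul_le_add_mul_sum_abs {c x y : ι → ℝ} {δ : ℝ} (hxy : ∀ i, |x i - y i| ≤ δ) :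
    ∑ i, c i * x i ≤ ∑ i, c i * y i + δ * ∑ i, |c i| := by
  rw [Finset.mul_sum, ← Finset.sum_add_distrib]
  refine Finset.sum_le_sum fun i _ => ?_
  have hle : c i * (x i - y i) ≤ δ * |c i| := by
    refine (le_abs_self _).trans ?_
    rw [abs_mul, mul_comm]
    exact mul_le_mul_of_nonneg_right (hxy i) (abs_nonneg _)
  linarith

theorem exists_summable_norm_le_of_coeffBounded (hY : IsOpen Y) (ha : ∀ y ∈ Y, CoeffBounded a y)
    {z₀ : ι → ℂ} (hz₀ : z₀ ∈ logPreimage Y) :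
    ∃ ρ > 0, ball z₀ ρ ⊆ logPreimage Y ∧ ∃ u : (ι → ℤ) → ℝ, Summable u ∧
      ∀ α, ∀ w ∈ ball z₀ ρ, ‖a α * laurentMonomial α w‖ ≤ u α := by
  obtain ⟨δ, hδ, C, hC⟩ := exists_norm_mul_exp_add_le hY ha hz₀.2
  have hnear : ∀ᶠ w in 𝓝 z₀, w ∈ logPreimage Y ∧ logNorm w ∈ closedBall (logNorm z₀) (δ / 2) :=
    ((isOpen_logPreimage hY).eventually_mem hz₀).and
      ((continuousAt_logNorm hz₀.1).eventually_mem (closedBall_mem_nhds _ (half_pos hδ)))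
  obtain ⟨ρ, hρ, hball⟩ := eventually_nhds_iff_ball.1 hnear
  refine ⟨ρ, hρ, fun w hw => (hball w hw).1, _,
    (summable_exp_neg_mul_sum_abs (half_pos hδ)).mul_left C, fun α w hw => ?_⟩
  obtain ⟨⟨hw0, -⟩, hwδ⟩ := hball w hw
  have hdist (i : ι) : |logNorm w i - logNorm z₀ i| ≤ δ / 2 :=
    (dist_le_pi_dist _ _ i).trans hwδ
  calc ‖a α * laurentMonomial α w‖
      = ‖a α‖ * Real.exp (∑ i, α i * logNorm w i) := by
        rw [norm_mul, norm_laurentMonomial α hw0]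
    _ ≤ ‖a α‖ * Real.exp ((∑ i, α i * logNorm z₀ i + δ * ∑ i, |(α i : ℝ)|) +
          -(δ / 2) * ∑ i, |(α i : ℝ)|) := by
        gcongr
        linarith [sum_mul_le_add_mul_sum_abs (c := fun i => (α i : ℝ)) hdist]
    _ ≤ C * Real.exp (-(δ / 2) * ∑ i, |(α i : ℝ)|) := by
        rw [Real.exp_add, ← mul_assoc]
        exact mul_le_mul_of_nonneg_right (hC α) (Real.exp_pos _).le

theorem summable_laurent_of_coeffBounded (hY : IsOpen Y) (ha : ∀ y ∈ Y, CoeffBounded a y)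
    {z : ι → ℂ} (hz : z ∈ logPreimage Y) : Summable fun α => a α * laurentMonomial α z :=
  have ⟨_, hρ, _, _, hu, hau⟩ := exists_summable_norm_le_of_coeffBounded hY ha hz
  .of_norm_bounded hu fun α => hau α z (mem_ball_self hρ)

theorem differentiableOn_tsum_laurent (hY : IsOpen Y) (ha : ∀ y ∈ Y, CoeffBounded a y) :
    DifferentiableOn ℂ (fun z => ∑' α, a α * laurentMonomial α z) (logPreimage Y) := by
  intro z hz
  obtain ⟨ρ, hρ, hρY, u, hu, hau⟩ := exists_summable_norm_le_of_coeffBounded hY ha hz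
  refine (differentiableAt_tsum_of_norm_le hu hρ (fun α w hw => ?_)
    hau).differentiableWithinAt
  exact ((differentiableAt_laurentMonomial fun i =>
    .inr ((hρY hw).1 i)).const_mul _).differentiableWithinAt

end Convergence

/-! ### Logarithmic convexity -/

section LogConvexity

variable {n : ℕ} {G : Set (Fin n → ℂ)} {f : (Fin n → ℂ) → ℂ} {F : Set ((Fin n → ℂ) → ℂ)}

theorem IsCircled.logNorm_mem_logSet_iff (hc : IsCircled G) {z : Fin n → ℂ}
    (hz : ∀ i, z i ≠ 0) : logNorm z ∈ logSet G ↔ z ∈ G := by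
  obtain ⟨t, ht⟩ := exists_rot_expPoint_logNorm hz
  refine ⟨fun h => ht ▸ hc.rot_mem t h, fun h => ?_⟩
  rw [logSet, mem_preimage, ← rot_zero (expPoint _), ← neg_add_cancel t, ← rot_rot, ht]
  exact hc.rot_mem (-t) h

theorem logSet_nonempty (hG : IsComplexDomain G) (hc : IsCircled G) : (logSet G).Nonempty := by
  obtain ⟨z₀, hz₀, h0⟩ := dense_forall_ne_zero.inter_open_nonempty G hG.1 hG.2.nonempty
  exact ⟨_, (hc.logNorm_mem_logSet_iff h0).2 hz₀⟩

theorem continuous_comp_rot (hc : IsCircled G) (hf : f ∈ holomorphicOn G) {z : Fin n → ℂ}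
    (hz : z ∈ G) : Continuous fun t => f (rot t z) :=
  (DifferentiableOn.continuousOn hf).comp_continuous (continuous_clm_apply.1 continuous_rot z)
    fun t => hc.rot_mem t hz

theorem coeffBounded_of_mem_logSet (hc : IsCircled G) (hf : f ∈ holomorphicOn G)
    {a : (Fin n → ℤ) → ℂ} (ha : ∀ α, IsLaurentCoeff G f α (a α)) {x : Fin n → ℝ}
    (hx : x ∈ logSet G) : CoeffBounded a x := by
  obtain ⟨C, hC⟩ := isCompact_univ.exists_bound_of_continuousOn
    (continuous_comp_rot hc hf hx).continuousOn
  refine ⟨C, fun α => ?_⟩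
  rw [← logNorm_expPoint x, ← norm_laurentMonomial α (expPoint_ne_zero x), ← norm_mul,
    ← ha α _ hx (expPoint_ne_zero x)]
  exact norm_torusCoeff_le fun t => hC t (mem_univ t)

theorem tsum_laurent_eq (hc : IsCircled G) (hf : f ∈ holomorphicOn G) {a : (Fin n → ℤ) → ℂ}
    (ha : ∀ α, IsLaurentCoeff G f α (a α)) {z : Fin n → ℂ} (hz : z ∈ G) (hz0 : ∀ i, z i ≠ 0)
    (hs : Summable fun α => a α * laurentMonomial α z) :
    ∑' α, a α * laurentMonomial α z = f z := by
  let φ : C(UnitAddTorus (Fin n), ℂ) := ⟨_, continuous_comp_rot hc hf hz⟩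
  have hcoeff : (fun α => a α * laurentMonomial α z) = mFourierCoeff φ :=
    funext fun α => (ha α z hz hz0).symm
  have hsum := hasSum_mFourier_series_apply_of_summable (f := φ) (hcoeff ▸ hs) 0
  rw [hcoeff]
  simpa [φ, mFourier, rot_zero] using hsum.tsum_eq

/-- Otherwise the Laurent series would continue all members of `F` to the Reinhardt domain
over `Y`. -/
theorem subset_logSet_of_coeffBounded (hF : F ⊆ holomorphicOn G) (hG : IsComplexDomain G)
    (hc : IsCircled G) (hD : IsDomainOfHolomorphyFor F G) {Y : Set (Fin n → ℝ)} (hYo : IsOpen Y)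
    (hYc : Convex ℝ Y) (hXY : (logSet G ∩ Y).Nonempty)
    (hb : ∀ f ∈ F, ∀ a : (Fin n → ℤ) → ℂ, (∀ α, IsLaurentCoeff G f α (a α)) →
      ∀ y ∈ Y, CoeffBounded a y) : Y ⊆ logSet G := by
  by_contra hnot
  obtain ⟨y, hy, hyG⟩ := not_subset.1 hnot
  obtain ⟨x₀, hx₀⟩ := hXY
  obtain ⟨r, hr, hrGY⟩ := Metric.isOpen_iff.1 ((isOpen_logSet hG.1).inter hYo) x₀ hx₀
  have hsub {z : Fin n → ℂ} (hz : z ∈ logPreimage (ball x₀ r)) : z ∈ G ∩ logPreimage Y :=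
    ⟨(hc.logNorm_mem_logSet_iff hz.1).1 (hrGY hz.2).1, hz.1, (hrGY hz.2).2⟩
  refine hD ⟨logPreimage (ball x₀ r), logPreimage Y,
    isComplexDomain_logPreimage isOpen_ball (convex_ball _ _) ⟨x₀, mem_ball_self hr⟩,
    isComplexDomain_logPreimage hYo hYc ⟨y, hy⟩, fun _ => hsub,
    fun h => hyG (h (expPoint_mem_logPreimage hy)), fun f hfF => ?_⟩
  choose a ha using exists_isLaurentCoeff hG hc (hF hfF)
  exact ⟨_, differentiableOn_tsum_laurent hYo (hb f hfF a ha), fun z hz =>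
    tsum_laurent_eq hc (hF hfF) ha (hsub hz).1 hz.1
      (summable_laurent_of_coeffBounded hYo (hb f hfF a ha) (hsub hz).2)⟩

theorem convex_logSet (hF : F ⊆ holomorphicOn G) (hG : IsComplexDomain G) (hc : IsCircled G)
    (hD : IsDomainOfHolomorphyFor F G) : Convex ℝ (logSet G) := by
  obtain ⟨x, hx⟩ := logSet_nonempty hG hc
  have hhull : convexHull ℝ (logSet G) ⊆ logSet G :=
    subset_logSet_of_coeffBounded hF hG hc hD (isOpen_logSet hG.1).convexHull
      (convex_convexHull ℝ _) ⟨x, hx, subset_convexHull ℝ _ hx⟩ fun f hf a ha =>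
        convexHull_min (fun y hy => coeffBounded_of_mem_logSet hc (hF hf) ha hy)
          (convex_setOf_coeffBounded a)
  exact convexHull_eq_self.1 (hhull.antisymm (subset_convexHull ℝ _))

end LogConvexity

/-! ### Completeness in a coordinate -/

section Completeness

variable {n : ℕ} {G : Set (Fin n → ℂ)} {F : Set ((Fin n → ℂ) → ℂ)} {j : Fin n}

/-- `G` is complete in the `j`-th coordinate: with each point it contains the closed disc obtained
by shrinking and rotating the `j`-th coordinate. -/
def IsCompleteIn (G : Set (Fin n → ℂ)) (j : Fin n) : Prop :=
  ∀ z ∈ G, ∀ w : ℂ, ‖w‖ ≤ ‖z j‖ → Function.update z j w ∈ G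

theorem IsFat.subset_of_inter_subset_closure (hfat : IsFat G) {U D : Set (Fin n → ℂ)}
    (hU : IsOpen U) (hD : Dense D) (h : U ∩ D ⊆ closure G) : U ⊆ G := by
  rw [hfat]
  exact interior_maximal ((hD.open_subset_closure_inter hU).trans
    (closure_minimal h isClosed_closure)) hU

theorem CoeffBounded.add_single {a : (Fin n → ℤ) → ℂ} {x : Fin n → ℝ} (hx : CoeffBounded a x)
    (ha : ∀ α, α j < 0 → a α = 0) {s : ℝ} (hs : s ≤ 0) :
    CoeffBounded a (x + Pi.single j s) := by
  obtain ⟨C, hC⟩ := hx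
  refine ⟨C, fun α => ?_⟩
  obtain hα | hα := lt_or_ge (α j) 0
  · simpa [ha α hα] using hC α
  · have hsum : ∑ i, (α i : ℝ) * (x + Pi.single j s : Fin n → ℝ) i = ∑ i, α i * x i + α j * s := by
      simp [mul_add, Finset.sum_add_distrib, Pi.single_apply]
    refine le_trans ?_ (hC α)
    rw [hsum]
    gcongr
    linarith [mul_nonpos_of_nonneg_of_nonpos (Int.cast_nonneg (R := ℝ) hα) hs]

theorem add_single_mem_logSet (hF : F ⊆ holomorphicOn G) (hG : IsComplexDomain G)
    (hc : IsCircled G) (hD : IsDomainOfHolomorphyFor F G)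
    (hj : ∀ f ∈ F, ∀ α a, IsLaurentCoeff G f α a → α j < 0 → a = 0) {x : Fin n → ℝ}
    (hx : x ∈ logSet G) {s : ℝ} (hs : s ≤ 0) : x + Pi.single j s ∈ logSet G := by
  have hsub : logSet G + LinearMap.single ℝ _ j '' Iic 0 ⊆ logSet G := by
    refine subset_logSet_of_coeffBounded hF hG hc hD (isOpen_logSet hG.1).add_right
      ((convex_logSet hF hG hc hD).add ((convex_Iic 0).linear_image _))
      ⟨x, hx, x, hx, 0, ⟨0, mem_Iic.2 le_rfl, map_zero _⟩, add_zero x⟩ ?_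
    rintro f hf a ha _ ⟨y, hy, _, ⟨t, ht, rfl⟩, rfl⟩
    exact (coeffBounded_of_mem_logSet hc (hF hf) ha hy).add_single
      (fun α => hj f hf α _ (ha α)) ht
  exact hsub ⟨x, hx, _, ⟨s, hs, rfl⟩, rfl⟩

theorem mem_of_update_mem_of_norm_lt (hc : IsCircled G)
    (hlog : ∀ x ∈ logSet G, ∀ s ≤ 0, x + Pi.single j s ∈ logSet G) {z : Fin n → ℂ}
    (hz0 : ∀ i, z i ≠ 0) {c : ℂ} (hzc : ‖z j‖ < ‖c‖) (hz : Function.update z j c ∈ G) :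
    z ∈ G := by
  have hc0 : c ≠ 0 := norm_pos_iff.1 ((norm_nonneg _).trans_lt hzc)
  have hupd : ∀ i, Function.update z j c i ≠ 0 :=
    (Function.forall_update_iff z fun _ w => w ≠ 0).2 ⟨hc0, fun i _ => hz0 i⟩
  have hmem := hlog _ ((hc.logNorm_mem_logSet_iff hupd).2 hz) (Real.log ‖z j‖ - Real.log ‖c‖)
    (sub_nonpos.2 (Real.log_le_log (norm_pos_iff.2 (hz0 j)) hzc.le))
  rw [← hc.logNorm_mem_logSet_iff hz0]
  convert hmem using 1
  ext i
  obtain rfl | hi := eq_or_ne i j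
  · simp [logNorm]
  · simp [logNorm, hi]

theorem mem_closure_setOf_norm_lt (w : ℂ) : w ∈ closure {c : ℂ | ‖w‖ < ‖c‖} := by
  have hcompl : {c : ℂ | ‖w‖ < ‖c‖} = (closedBall 0 ‖w‖)ᶜ := by
    ext c
    simp
  rw [hcompl, closure_compl, interior_closedBall']
  simp

/-- The monotonicity of the logarithmic image gives completeness at points with nonzero
coordinates; fatness fills in the coordinate hyperplanes. -/
theorem isCompleteIn_of_coeff_eq_zero (hF : F ⊆ holomorphicOn G) (hG : IsComplexDomain G)
    (hc : IsCircled G) (hfat : IsFat G) (hD : IsDomainOfHolomorphyFor F G)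
    (hj : ∀ f ∈ F, ∀ α a, IsLaurentCoeff G f α a → α j < 0 → a = 0) : IsCompleteIn G j := by
  have hopen : IsOpen (⋃ c : ℂ, {v : Fin n → ℂ | ‖v j‖ < ‖c‖ ∧ Function.update v j c ∈ G}) :=
    isOpen_iUnion fun c => (isOpen_lt (continuous_apply j).norm continuous_const).inter
      (hG.1.preimage (continuous_id.update j continuous_const))
  have hsub : (⋃ c : ℂ, {v : Fin n → ℂ | ‖v j‖ < ‖c‖ ∧ Function.update v j c ∈ G}) ⊆ G := by
    refine hfat.subset_of_inter_subset_closure hopen dense_forall_ne_zero ?_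
    rintro v ⟨hv, hv0⟩
    obtain ⟨c, hvc, hcG⟩ := mem_iUnion.1 hv
    exact subset_closure (mem_of_update_mem_of_norm_lt hc
      (fun _ hx _ hs => add_single_mem_logSet hF hG hc hD hj hx hs) hv0 hvc hcG)
  intro z hz w hw
  obtain ⟨c, hcG, hzc⟩ := mem_closure_iff.1 (mem_closure_setOf_norm_lt (z j))
    (Function.update z j ⁻¹' G) (hG.1.preimage (continuous_const.update j continuous_id))
    (by simpa using hz)
  exact hsub (mem_iUnion.2 ⟨c, by simpa using hw.trans_lt hzc, by simpa using hcG⟩)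

theorem IsCompleteIn.add_single_mem_logSet (hj : IsCompleteIn G j) {x : Fin n → ℝ}
    (hx : x ∈ logSet G) {s : ℝ} (hs : s ≤ 0) : x + Pi.single j s ∈ logSet G := by
  have hmem := hj _ hx (Real.exp (x j + s) : ℝ) (by
    rw [norm_expPoint_apply, Complex.norm_real, Real.norm_of_nonneg (Real.exp_pos _).le]
    gcongr
    linarith)
  rw [logSet, mem_preimage]
  convert hmem using 1
  ext i
  obtain rfl | hi := eq_or_ne i j
  · simp [expPoint]
  · simp [expPoint, hi]

theorem piecewise_mem_of_isCompleteIn (S : Finset (Fin n)) (hS : ∀ j ∈ S, IsCompleteIn G j)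
    {z v : Fin n → ℂ} (hz : z ∈ G) (hv : ∀ j ∈ S, ‖v j‖ ≤ ‖z j‖) : S.piecewise v z ∈ G := by
  induction S using Finset.induction_on with
  | empty => simpa
  | insert j S hj ih =>
    rw [Finset.forall_mem_insert] at hS hv
    rw [Finset.piecewise_insert]
    refine hS.1 _ (ih hS.2 hv.2) _ ?_
    rw [Finset.piecewise_eq_of_notMem _ _ _ hj]
    exact hv.1

theorem partialHull_subset {ε : Fin n → Fin 2} (h : ∀ j, ε j = 1 → IsCompleteIn G j) :
    partialHull ε G ⊆ G := by
  rintro _ ⟨l, hl, z, hz, rfl⟩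
  have hmem := piecewise_mem_of_isCompleteIn (Finset.univ.filter fun j => ε j = 1)
    (fun j hj => h j (Finset.mem_filter.1 hj).2) (v := fun j => l j * z j) hz fun j _ => by
      rw [norm_mul]
      exact mul_le_of_le_one_left (norm_nonneg _) (hl j)
  convert hmem using 1
  ext j
  obtain hj | hj : ε j = 0 ∨ ε j = 1 := by omega
  · simp [Finset.piecewise, hj]
  · simp [Finset.piecewise, hj]

theorem isCompleteIn_of_partialHull_subset {ε : Fin n → Fin 2} (h : partialHull ε G ⊆ G)
    (hj : ε j = 1) : IsCompleteIn G j := by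
  intro z hz w hw
  have hdiv : w = w / z j * z j := by
    obtain hz0 | hz0 := eq_or_ne (z j) 0
    · simpa [hz0] using hw
    · rw [div_mul_cancel₀ _ hz0]
  refine h ⟨Function.update (1 : Fin n → ℂ) j (w / z j),
    (Function.forall_update_iff _ fun _ (c : ℂ) => ‖c‖ ≤ 1).2 ⟨?_, fun _ _ => by simp⟩, z, hz, ?_⟩
  · rw [norm_div]
    exact div_le_one_of_le₀ hw (norm_nonneg _)
  · ext i
    obtain rfl | hi := eq_or_ne i j
    · simpa [hj] using hdiv
    · simp [hi]

end Completeness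

/-! ### The class `𝒜^∞` -/

section SpaceAInfty

variable {n : ℕ} {G : Set (Fin n → ℂ)} {f : (Fin n → ℂ) → ℂ} {α : Fin n → ℤ} {a : ℂ}

theorem holomorphicOn_iterate_partialDeriv (hG : IsOpen G) (hf : f ∈ holomorphicOn G)
    (j : Fin n) (m : ℕ) : (partialDeriv j)^[m] f ∈ holomorphicOn G := by
  induction m with
  | zero => exact hf
  | succ m ih =>
    rw [Function.iterate_succ_apply']
    exact holomorphicOn_partialDeriv hG ih j

theorem holomorphicOn_foldr_partialDeriv (hG : IsOpen G) (hf : f ∈ holomorphicOn G)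
    (ν : Fin n → ℕ) (l : List (Fin n)) :
    l.foldr (fun j g => (partialDeriv j)^[ν j] g) f ∈ holomorphicOn G := by
  induction l with
  | nil => exact hf
  | cons j l ih => exact holomorphicOn_iterate_partialDeriv hG ih j _

theorem holomorphicOn_multiDeriv (hG : IsOpen G) (hf : f ∈ holomorphicOn G) (ν : Fin n → ℕ) :
    multiDeriv ν f ∈ holomorphicOn G :=
  holomorphicOn_foldr_partialDeriv hG hf ν _

theorem IsLaurentCoeff.iterate_partialDeriv (ha : IsLaurentCoeff G f α a) (hG : IsOpen G)
    (hc : IsCircled G) (hf : f ∈ holomorphicOn G) (j : Fin n) (m : ℕ) :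
    IsLaurentCoeff G ((NCircled.partialDeriv j)^[m] f) (α - Pi.single j (m : ℤ))
      ((∏ k ∈ Finset.range m, (α j - k : ℂ)) * a) := by
  induction m with
  | zero => simpa using ha
  | succ m ih =>
    rw [Function.iterate_succ_apply']
    convert ih.partialDeriv hG hc (holomorphicOn_iterate_partialDeriv hG hf j m) j using 1
    · rw [sub_sub, ← Pi.single_add, Nat.cast_succ]
    · rw [Finset.prod_range_succ_comm, mul_assoc]
      simp

theorem IsLaurentCoeff.foldr_partialDeriv (ha : IsLaurentCoeff G f α a) (hG : IsOpen G)
    (hc : IsCircled G) (hf : f ∈ holomorphicOn G) (ν : Fin n → ℕ) {l : List (Fin n)}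
    (hl : l.Nodup) :
    IsLaurentCoeff G (l.foldr (fun j g => (NCircled.partialDeriv j)^[ν j] g) f)
      (fun i => if i ∈ l then α i - ν i else α i)
      ((l.map fun j => ∏ k ∈ Finset.range (ν j), (α j - k : ℂ)).prod * a) := by
  induction l with
  | nil => simpa using ha
  | cons j l ih =>
    obtain ⟨hj, hl⟩ := List.nodup_cons.1 hl
    have hα : (fun i => if i ∈ j :: l then α i - ν i else α i) =
        (fun i => if i ∈ l then α i - ν i else α i) - Pi.single j (ν j : ℤ) := by
      ext i
      obtain rfl | hi := eq_or_ne i j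
      · simp [hj]
      · simp [hi]
    have hj' := (ih hl).iterate_partialDeriv hG hc (holomorphicOn_foldr_partialDeriv hG hf ν l) j
      (ν j)
    simpa only [hα, hj, if_false, List.foldr_cons, List.map_cons, List.prod_cons, mul_assoc]
      using hj'

theorem IsLaurentCoeff.multiDeriv (ha : IsLaurentCoeff G f α a) (hG : IsOpen G)
    (hc : IsCircled G) (hf : f ∈ holomorphicOn G) (ν : Fin n → ℕ) :
    IsLaurentCoeff G (multiDeriv ν f) (fun i => α i - ν i)
      ((∏ j, ∏ k ∈ Finset.range (ν j), (α j - k : ℂ)) * a) := by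
  simpa [Fin.prod_univ_def, NCircled.multiDeriv] using
    ha.foldr_partialDeriv hG hc hf ν (List.nodup_finRange n)

theorem IsLaurentCoeff.exists_multiDeriv_negPart (ha : IsLaurentCoeff G f α a) (ha0 : a ≠ 0)
    (hG : IsOpen G) (hc : IsCircled G) (hf : f ∈ holomorphicOn G) :
    ∃ (ν : Fin n → ℕ) (b : ℂ), b ≠ 0 ∧ IsLaurentCoeff G (NCircled.multiDeriv ν f) (-α⁻) b := by
  have hα : (fun i => α i - (α i).toNat) = -α⁻ := by
    ext i
    rw [Int.ofNat_toNat, ← posPart_def, Pi.neg_apply, Pi.negPart_apply, sub_eq_iff_eq_add,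
      neg_add_eq_sub, posPart_sub_negPart]
  refine ⟨_, _, mul_ne_zero ?_ ha0, hα ▸ ha.multiDeriv hG hc hf fun j => (α j).toNat⟩
  refine Finset.prod_ne_zero_iff.2 fun j _ => Finset.prod_ne_zero_iff.2 fun k hk => ?_
  rw [Finset.mem_range, Int.lt_toNat] at hk
  exact_mod_cast sub_ne_zero.2 hk.ne'

theorem spaceAInfty_subset_holomorphicOn : spaceAInfty G ⊆ holomorphicOn G := fun _ hf =>
  (mem_iInter.1 hf 0).1

theorem exists_norm_multiDeriv_le (hb : Bornology.IsBounded G) (hf : f ∈ spaceAInfty G)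
    (ν : Fin n → ℕ) : ∃ C, ∀ z ∈ G, ‖multiDeriv ν f z‖ ≤ C := by
  obtain ⟨g, hg, hgf⟩ := (mem_iInter.1 hf (∑ j, ν j)).2 ν le_rfl
  obtain ⟨C, hC⟩ := hb.isCompact_closure.exists_bound_of_continuousOn hg
  exact ⟨C, fun z hz => hgf hz ▸ hC z (subset_closure hz)⟩

theorem mem_spaceAInfty_of_closure_subset {Ω : Set (Fin n → ℂ)} (hΩ : IsOpen Ω)
    (hG : closure G ⊆ Ω) (hf : f ∈ holomorphicOn Ω) : f ∈ spaceAInfty G :=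
  mem_iInter.2 fun _ => ⟨DifferentiableOn.mono hf (subset_closure.trans hG), fun ν _ =>
    ⟨multiDeriv ν f, (DifferentiableOn.continuousOn (holomorphicOn_multiDeriv hΩ hf ν)).mono hG,
      fun _ _ => rfl⟩⟩

theorem IsLaurentCoeff.norm_le (ha : IsLaurentCoeff G f α a) (hc : IsCircled G) {C : ℝ}
    (hC : ∀ z ∈ G, ‖f z‖ ≤ C) {z : Fin n → ℂ} (hz : z ∈ G) (hz0 : ∀ i, z i ≠ 0) :
    ‖a‖ ≤ C * ‖laurentMonomial (-α) z‖ := by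
  have hinv : laurentMonomial α z * laurentMonomial (-α) z = 1 := by
    rw [← laurentMonomial_add fun i => .inl (hz0 i), add_neg_cancel]
    simp [laurentMonomial]
  calc ‖a‖ = ‖torusCoeff f α z‖ * ‖laurentMonomial (-α) z‖ := by
        rw [ha z hz hz0, ← norm_mul, mul_assoc, hinv, mul_one]
    _ ≤ C * ‖laurentMonomial (-α) z‖ := by
        gcongr
        exact norm_torusCoeff_le fun t => hC _ (hc.rot_mem t hz)

/-- The derivative of order `α⁺` has a nonzero coefficient at `-α⁻`, which would make it unbounded
near `{z_j = 0}`. -/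
theorem IsLaurentCoeff.eq_zero_of_mem_closure (ha : IsLaurentCoeff G f α a) (hG : IsOpen G)
    (hc : IsCircled G) (hb : Bornology.IsBounded G) (hf : f ∈ spaceAInfty G) {p : Fin n → ℂ}
    (hp : p ∈ closure G) {j : Fin n} (hpj : p j = 0) (hα : α j < 0) : a = 0 := by
  by_contra ha0
  obtain ⟨ν, b, hb0, hbν⟩ := ha.exists_multiDeriv_negPart ha0 hG hc
    (spaceAInfty_subset_holomorphicOn hf)
  obtain ⟨C, hC⟩ := exists_norm_multiDeriv_le hb hf ν
  have hle : G ∩ {z | ∀ i, z i ≠ 0} ⊆ {z | ‖b‖ ≤ C * ‖laurentMonomial α⁻ z‖} := by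
    rintro z ⟨hz, hz0⟩
    simpa using hbν.norm_le hc hC hz hz0
  have hclosed : IsClosed {z | ‖b‖ ≤ C * ‖laurentMonomial α⁻ z‖} :=
    isClosed_le continuous_const
      ((differentiable_laurentMonomial_negPart α).continuous.norm.const_mul C)
  have hbp : ‖b‖ ≤ C * ‖laurentMonomial α⁻ p‖ :=
    closure_minimal hle hclosed (closure_subset_closure_inter_forall_ne_zero hG hp)
  rw [laurentMonomial_eq_zero (by simpa using hα) hpj, norm_zero, mul_zero] at hbp
  exact hb0 (norm_le_zero_iff.1 hbp)

end SpaceAInfty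

/-! ### Separation by Laurent monomials -/

section Separation

variable {ι : Type*} [Fintype ι]

theorem exists_sum_mul_lt_of_notMem_closure [DecidableEq ι] {X : Set (ι → ℝ)} (hX : Convex ℝ X)
    (hne : X.Nonempty) {J : Set ι}
    (hJ : ∀ j ∈ J, ∀ x ∈ X, ∀ s ≤ (0 : ℝ), x + Pi.single j s ∈ X) {y : ι → ℝ}
    (hy : y ∉ closure X) :
    ∃ (β : ι → ℝ) (u : ℝ), (∀ j ∈ J, 0 ≤ β j) ∧ (∀ x ∈ X, ∑ i, β i * x i < u) ∧
      u < ∑ i, β i * y i := by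
  obtain ⟨φ, u, hφX, hφy⟩ := geometric_hahn_banach_closed_point hX.closure isClosed_closure hy
  have hsingle (j : ι) (s : ℝ) : φ (Pi.single j s) = φ (Pi.single j 1) * s := by
    rw [mul_comm, ← smul_eq_mul, ← map_smul, ← Pi.single_smul, smul_eq_mul, mul_one]
  have hφ (x : ι → ℝ) : φ x = ∑ i, φ (Pi.single i 1) * x i := by
    simp only [← hsingle, ← map_sum, Finset.univ_sum_single]
  refine ⟨fun i => φ (Pi.single i 1), u, fun j hj => ?_,
    fun x hx => hφ x ▸ hφX x (subset_closure hx), hφ y ▸ hφy⟩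
  by_contra! hneg
  obtain ⟨x, hx⟩ := hne
  have hs : (u - φ x) / φ (Pi.single j 1) ≤ 0 :=
    div_nonpos_of_nonneg_of_nonpos (sub_nonneg.2 (hφX x (subset_closure hx)).le) hneg.le
  have hlt := hφX _ (subset_closure (hJ j hj x hx _ hs))
  rw [map_add, hsingle, mul_div_cancel₀ _ hneg.ne, add_sub_cancel] at hlt
  exact hlt.false

/-- Round up a large multiple of `β`: the error stays bounded above on `X`, while the gap grows. -/
theorem exists_int_sum_mul_le {X : Set (ι → ℝ)} {R : ℝ} (hR : ∀ x ∈ X, ∀ i, x i ≤ R) {β : ι → ℝ}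
    {u : ℝ} (hX : ∀ x ∈ X, ∑ i, β i * x i ≤ u) {y : ι → ℝ} (hy : u < ∑ i, β i * y i) :
    ∃ (α : ι → ℤ) (c : ℝ), (∀ i, 0 ≤ β i → 0 ≤ α i) ∧ (∀ x ∈ X, ∑ i, α i * x i ≤ c) ∧
      c < ∑ i, α i * y i := by
  obtain ⟨N, hN⟩ := exists_nat_gt ((∑ i, |y i - R|) / (∑ i, β i * y i - u))
  rw [div_lt_iff₀ (sub_pos.2 hy)] at hN
  refine ⟨fun i => ⌈N * β i⌉,
    ∑ i, ⌈N * β i⌉ * y i - (N * (∑ i, β i * y i - u) - ∑ i, |y i - R|),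
    fun i hi => Int.ceil_nonneg (mul_nonneg N.cast_nonneg hi), fun x hx => ?_, by linarith⟩
  have herror (i : ι) : (⌈N * β i⌉ - N * β i) * (x i - y i) ≤ |y i - R| := by
    have h0 : 0 ≤ ⌈N * β i⌉ - N * β i := sub_nonneg.2 (Int.le_ceil _)
    have h1 : ⌈N * β i⌉ - N * β i ≤ 1 := by linarith [Int.ceil_lt_add_one (N * β i)]
    calc (⌈N * β i⌉ - N * β i) * (x i - y i)
        ≤ (⌈N * β i⌉ - N * β i) * |y i - R| := by
          gcongr
          linarith [hR x hx i, neg_le_abs (y i - R)]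
      _ ≤ |y i - R| := mul_le_of_le_one_left (abs_nonneg _) h1
  have hsplit : ∑ i, ⌈N * β i⌉ * x i - ∑ i, ⌈N * β i⌉ * y i =
      N * (∑ i, β i * x i - ∑ i, β i * y i) + ∑ i, (⌈N * β i⌉ - N * β i) * (x i - y i) := by
    simp only [← Finset.sum_sub_distrib, Finset.mul_sum, ← Finset.sum_add_distrib]
    exact Finset.sum_congr rfl fun i _ => by ring
  have hgap : N * (∑ i, β i * x i - ∑ i, β i * y i) ≤ N * (u - ∑ i, β i * y i) := by
    gcongr
    exact hX x hx
  linarith [Finset.sum_le_sum fun i (_ : i ∈ Finset.univ) => herror i]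

theorem isOpen_setOf_laurentMonomial_ne (α : ι → ℤ) (m : ℂ) :
    IsOpen {z : ι → ℂ | (∀ i, 0 ≤ α i ∨ z i ≠ 0) ∧ laurentMonomial α z ≠ m} := by
  rw [isOpen_iff_mem_nhds]
  rintro z ⟨hz, hzm⟩
  have hreg (i : ι) : ∀ᶠ w : ι → ℂ in 𝓝 z, 0 ≤ α i ∨ w i ≠ 0 :=
    (hz i).elim (fun h => .of_forall fun _ => .inl h) fun h =>
      ((continuous_apply i).continuousAt.eventually_ne h).mono fun _ => .inr
  exact (eventually_all.2 hreg).and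
    ((differentiableAt_laurentMonomial hz).continuousAt.eventually_ne hzm)

/-- After clearing denominators, `f z * (z^{α⁺} - m z^{α⁻}) = z^{α⁻}` propagates from `V` to `U`. -/
theorem laurentMonomial_ne_of_eqOn_inv {f : (ι → ℂ) → ℂ} {α : ι → ℤ} {m : ℂ} {U V : Set (ι → ℂ)}
    (hU : IsOpen U) (hUc : IsPreconnected U) (hf : DifferentiableOn ℂ f U) (hV : IsOpen V)
    (hVne : V.Nonempty) (hVU : V ⊆ U) (hVm : ∀ z ∈ V, laurentMonomial α z ≠ m)
    (hfV : EqOn f (fun z => (laurentMonomial α z - m)⁻¹) V) {b : ι → ℂ} (hb : b ∈ U)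
    (hb0 : ∀ i, b i ≠ 0) : laurentMonomial α b ≠ m := by
  obtain ⟨q, hq, hq0⟩ := dense_forall_ne_zero.inter_open_nonempty V hV hVne
  let d (z : ι → ℂ) : ℂ :=
    f z * (laurentMonomial α⁺ z - m * laurentMonomial α⁻ z) - laurentMonomial α⁻ z
  have hpos : Differentiable ℂ (laurentMonomial α⁺) := differentiable_laurentMonomial_posPart α
  have hneg : Differentiable ℂ (laurentMonomial α⁻) := differentiable_laurentMonomial_negPart α
  have hd : DifferentiableOn ℂ d U :=
    (hf.mul (hpos.sub (hneg.const_mul m)).differentiableOn).sub hneg.differentiableOn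
  have hdq : ∀ᶠ z in 𝓝 q, d z = 0 := by
    filter_upwards [hV.mem_nhds hq, isOpen_forall_ne_zero.mem_nhds hq0] with z hz hz0
    simp only [d]
    rw [hfV hz, ← laurentMonomial_negPart_mul hz0, mul_comm m, ← mul_sub, mul_comm _ (_ - m),
      inv_mul_cancel_left₀ (sub_ne_zero.2 (hVm z hz)), sub_self]
  rintro rfl
  have hdb : d b = 0 := eqOn_zero_of_isPreconnected hU hUc hd (hVU hq) hdq hb
  simp only [d] at hdb
  rw [← laurentMonomial_negPart_mul hb0, mul_comm (laurentMonomial α b), sub_self, mul_zero,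
    zero_sub, neg_eq_zero] at hdb
  exact laurentMonomial_ne_zero (fun i => .inr (hb0 i)) hdb

end Separation

/-! ### Functions of class `𝒜^∞` with prescribed singularities -/

section Extension

variable {n : ℕ} {G : Set (Fin n → ℂ)} {α : Fin n → ℤ}

theorem exists_le_of_mem_logSet (hb : Bornology.IsBounded G) :
    ∃ R, ∀ x ∈ logSet G, ∀ i, x i ≤ R := by
  obtain ⟨R, hR⟩ := hb.exists_norm_le
  refine ⟨R, fun x hx i => ?_⟩
  calc x i ≤ Real.exp (x i) := by linarith [Real.add_one_le_exp (x i)]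
    _ = ‖expPoint x i‖ := (norm_expPoint_apply x i).symm
    _ ≤ R := (norm_le_pi_norm _ i).trans (hR _ hx)

theorem IsCircled.logNorm_notMem_closure_logSet (hc : IsCircled G) {b : Fin n → ℂ}
    (hb : ∀ i, b i ≠ 0) (hbG : b ∉ closure G) : logNorm b ∉ closure (logSet G) := by
  obtain ⟨t, ht⟩ := exists_rot_expPoint_logNorm hb
  contrapose! hbG
  rw [← ht]
  exact map_mem_closure (f := fun x => rot t (expPoint x))
    ((rot t).continuous.comp continuous_expPoint) hbG fun x hx => hc.rot_mem t hx

theorem norm_laurentMonomial_le_of_mem_closure (hG : IsOpen G) (hc : IsCircled G) {c : ℝ}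
    (hα : ∀ x ∈ logSet G, ∑ i, α i * x i ≤ c) {z : Fin n → ℂ} (hz : z ∈ closure G)
    (hz0 : ∀ i, 0 ≤ α i ∨ z i ≠ 0) : ‖laurentMonomial α z‖ ≤ Real.exp c := by
  have hmaps : MapsTo (laurentMonomial α) (G ∩ {z | ∀ i, z i ≠ 0}) (closedBall 0 (Real.exp c)) := by
    rintro w ⟨hw, hw0⟩
    rw [mem_closedBall_zero_iff, norm_laurentMonomial α hw0, Real.exp_le_exp]
    exact hα _ ((hc.logNorm_mem_logSet_iff hw0).2 hw)
  have hmem := (differentiableAt_laurentMonomial hz0).continuousAt.continuousWithinAt.mem_closure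
    (closure_subset_closure_inter_forall_ne_zero hG hz) hmaps
  rwa [isClosed_closedBall.closure_eq, mem_closedBall_zero_iff] at hmem

theorem inv_laurentMonomial_sub_mem_spaceAInfty {m : ℂ}
    (hα : ∀ z ∈ closure G, (∀ i, 0 ≤ α i ∨ z i ≠ 0) ∧ laurentMonomial α z ≠ m) :
    (fun z => (laurentMonomial α z - m)⁻¹) ∈ spaceAInfty G :=
  mem_spaceAInfty_of_closure_subset (isOpen_setOf_laurentMonomial_ne α m) hα fun _ hz =>
    (((differentiableAt_laurentMonomial hz.1).sub_const m).fun_inv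
      (sub_ne_zero.2 hz.2)).differentiableWithinAt

theorem exists_inv_laurentMonomial_sub_mem_spaceAInfty (hG : IsComplexDomain G)
    (hb : Bornology.IsBounded G) (hc : IsCircled G) (hconv : Convex ℝ (logSet G))
    (hJ : ∀ p ∈ closure G, ∀ j, p j = 0 → IsCompleteIn G j) {b : Fin n → ℂ}
    (hb0 : ∀ i, b i ≠ 0) (hbG : b ∉ closure G) :
    ∃ α, (∀ z ∈ G, laurentMonomial α z ≠ laurentMonomial α b) ∧
      (fun z => (laurentMonomial α z - laurentMonomial α b)⁻¹) ∈ spaceAInfty G := by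
  obtain ⟨β, u, hβ, hβX, hβb⟩ := exists_sum_mul_lt_of_notMem_closure hconv (logSet_nonempty hG hc)
    (J := {j | ∃ p ∈ closure G, p j = 0})
    (fun j ⟨p, hp, hpj⟩ _ hx _ hs => (hJ p hp j hpj).add_single_mem_logSet hx hs)
    (hc.logNorm_notMem_closure_logSet hb0 hbG)
  obtain ⟨R, hR⟩ := exists_le_of_mem_logSet hb
  obtain ⟨α, c, hα, hαX, hαb⟩ := exists_int_sum_mul_le hR (fun x hx => (hβX x hx).le) hβb
  have hreg (z : Fin n → ℂ) (hz : z ∈ closure G) (i : Fin n) : 0 ≤ α i ∨ z i ≠ 0 :=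
    or_iff_not_imp_right.2 fun h => hα i (hβ i ⟨z, hz, not_not.1 h⟩)
  have hne (z : Fin n → ℂ) (hz : z ∈ closure G) : laurentMonomial α z ≠ laurentMonomial α b := by
    refine ne_of_apply_ne norm (ne_of_lt ?_)
    calc ‖laurentMonomial α z‖ ≤ Real.exp c :=
          norm_laurentMonomial_le_of_mem_closure hG.1 hc hαX hz (hreg z hz)
      _ < ‖laurentMonomial α b‖ := by rwa [norm_laurentMonomial α hb0, Real.exp_lt_exp]
  exact ⟨α, fun z hz => hne z (subset_closure hz),
    inv_laurentMonomial_sub_mem_spaceAInfty fun z hz => ⟨hreg z hz, hne z hz⟩⟩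

theorem isDomainOfHolomorphyFor_spaceAInfty (hG : IsComplexDomain G)
    (hb : Bornology.IsBounded G) (hfat : IsFat G) (hc : IsCircled G)
    (hconv : Convex ℝ (logSet G)) (hJ : ∀ p ∈ closure G, ∀ j, p j = 0 → IsCompleteIn G j) :
    IsDomainOfHolomorphyFor (spaceAInfty G) G := by
  rintro ⟨G₀, G', hG₀, hG', hsub, hnot, hext⟩
  obtain ⟨b, ⟨hbG', hb0⟩, hbG⟩ := not_subset.1 <|
    mt (hfat.subset_of_inter_subset_closure hG'.1 dense_forall_ne_zero) hnot
  obtain ⟨α, hα, hfα⟩ :=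
    exists_inv_laurentMonomial_sub_mem_spaceAInfty hG hb hc hconv hJ hb0 hbG
  obtain ⟨f, hf, hfG₀⟩ := hext _ hfα
  exact laurentMonomial_ne_of_eqOn_inv hG'.1 hG'.2.isPreconnected hf hG₀.1 hG₀.2.nonempty
    (fun z hz => (hsub hz).2) (fun z hz => hα z (hsub hz).1) hfG₀ hbG' hb0 rfl

theorem isCompleteIn_of_mem (hG : IsComplexDomain G) (hc : IsCircled G) (hfat : IsFat G)
    (hD : IsDomainOfHolomorphy G) {p : Fin n → ℂ} (hp : p ∈ G) {j : Fin n} (hpj : p j = 0) :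
    IsCompleteIn G j :=
  isCompleteIn_of_coeff_eq_zero subset_rfl hG hc hfat hD fun _ hf _ _ ha hα =>
    ha.eq_zero_of_mem hG.1 hc hf hp hpj hα

theorem isCompleteIn_of_mem_closure (hG : IsComplexDomain G) (hb : Bornology.IsBounded G)
    (hc : IsCircled G) (hfat : IsFat G) (hD : IsDomainOfHolomorphyFor (spaceAInfty G) G)
    {p : Fin n → ℂ} (hp : p ∈ closure G) {j : Fin n} (hpj : p j = 0) : IsCompleteIn G j :=
  isCompleteIn_of_coeff_eq_zero spaceAInfty_subset_holomorphicOn hG hc hfat hD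
    fun _ hf _ _ ha hα => ha.eq_zero_of_mem_closure hG.1 hc hb hf hp hpj hα

theorem isCompleteIn_of_mem_frontier
    (h : ∀ ε : Fin n → Fin 2, (stratum ε ∩ frontier G).Nonempty → partialHull ε G ⊆ G)
    {p : Fin n → ℂ} (hp : p ∈ frontier G) {j : Fin n} (hpj : p j = 0) : IsCompleteIn G j := by
  let ε (i : Fin n) : Fin 2 := if p i = 0 then 1 else 0
  have hpε : p ∈ stratum ε := ⟨fun i hi => by simpa [ε] using hi, fun i hi => by simpa [ε] using hi⟩
  exact isCompleteIn_of_partialHull_subset (h ε ⟨p, hpε, hp⟩) (by simp [ε, hpj])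

end Extension

end NCircled

open NCircled

theorem corollary6 (n : ℕ) (G : Set (Fin n → ℂ))
    (hdom : NCircled.IsComplexDomain G)
    (hbdd : Bornology.IsBounded G)
    (hfat : NCircled.IsFat G)
    (hcirc : NCircled.IsCircled G)
    (hhol : NCircled.IsDomainOfHolomorphy G) :
    NCircled.IsDomainOfHolomorphyFor (NCircled.spaceAInfty G) G ↔
      ∀ ε : Fin n → Fin 2, (NCircled.stratum ε ∩ frontier G).Nonempty →
        NCircled.partialHull ε G ⊆ G := by
  constructor
  · rintro hA ε ⟨p, ⟨hpε, -⟩, hp⟩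
    exact partialHull_subset fun j hj => isCompleteIn_of_mem_closure hdom hbdd hcirc hfat hA
      (frontier_subset_closure hp) (hpε j hj)
  · intro hhull
    have hcomplete (p : Fin n → ℂ) (hp : p ∈ closure G) (j : Fin n) (hpj : p j = 0) :
        IsCompleteIn G j := by
      rw [closure_eq_self_union_frontier] at hp
      obtain hpG | hpG := hp
      · exact isCompleteIn_of_mem hdom hcirc hfat hhol hpG hpj
      · exact isCompleteIn_of_mem_frontier hhull hpG hpj
    exact isDomainOfHolomorphyFor_spaceAInfty hdom hbdd hfat hcirc
      (convex_logSet subset_rfl hdom hcirc hhol) hcomplete
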